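/- Let $(n_j)_{j\ge 1}$ be a sequence of non-negative integers with $n_j\to\infty$. For primes $j\ge 3$ put $$\alpha_j=\frac{\pi}{j}+2^{n_j+1}\pi,\qquad \beta_j=\frac{\pi}{j}+3\cdot 2^{n_j}\pi,$$ and let $$Z=\{i\alpha_j : j\ \text{prime},\ j\ge 3\}\cup\{i\beta_j : j\ \text{prime},\ j\ge 3\}.$$ For $N=0,1,2,\dots$ let $X_N=\overline{\exp(2^{-N}Z)}\subset\mathbb C$, let $X=\varprojlim\{X_N,\ z\mapsto z^2\}$, i.e. the space of all sequences $\xi=(\xi_N)_{N\ge 0}$ with $\xi_N\in X_N$ and $\xi_{N+1}^2=\xi_N$, with the topology of coordinatewise convergence, and let $\pi_N\in C(X)$ be the projection $\pi_N(\xi)=\xi_N$. Then: 1. $Z$ is a closed subset of $i\mathbb R$. 2. For every $N$, the set $\mathsf A(X_N)=\{z\in X_N : -z\in X_N\}$ equals $\{\pm\exp(2^{-N}\alpha_j i) : j\ge 3\ \text{prime},\ n_j=N\}$. (So if $(n_j)$ is strictly increasing, then $\mathsf A(X_{n_j})=\{\pm\exp(2^{-n_j}\alpha_j i)\}$ for each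 prime $j\ge3$, and $\mathsf A(X_N)=\varnothing$ for all other $N$.) 3. $\pi_N\to 1$ pointwise on $X$, but not uniformly on $X$. 4. Let $H$ be an infinite-dimensional separable complex Hilbert space, $\mathcal B(H)$ the algebra of bounded operators on $H$, $\mathcal Q(H)=\mathcal B(H)/\mathcal K(H)$ its Calkin algebra and $\pi:\mathcal B(H)\to\mathcal Q(H)$ the quotient map. Let $\tau:C(X)\to\mathcal Q(H)$ be a unital $*$-monomorphism representing the zero element of $\mathrm{Ext}(X)$, that is, $\tau$ is of the form $\tau(g)=\pi(U)^*\,\pi\big(\bigoplus_i g(p_i)I_{H_i}\big)\,\pi(U)$ with $U\in\mathcal B(H)$ unitary, $H=\bigoplus_{i=1}^\infty H_i$ an orthogonal decomposition into infinite-dimensional closed subspaces and $(p_i)$ a dense sequence in $X$; such $\tau$ exist. Let $(q(t))$, for $t$ a positive dyadic rational, be the dyadic semigroup in $\mathcal Q(H)$ with $q(2^{-m})=\tau(\pi_m)$, i.e. $q(k2^{-m})=\tau(\pi_m)^k$. Then $(q(t))$ is a $C_0$-semigroup with respect to every Calkin representation: for every nonprincipal ultrafilter $\mathcal U$ on $\mathbb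 N$ there is a $C_0$-semigroup $(T(t))_{t\ge 0}$ of bounded operators on the Hilbert space $\mathbb H_{\mathcal U}$ with $T(t)=\gamma_{\mathcal U}(q(t))$ for every positive dyadic $t$. However, $(q(t))$ is not uniformly continuous: $\|q(t)-1\|_{\mathcal Q(H)}$ does not tend to $0$ as $t\to 0^+$ through positive dyadic rationals. Here $\mathbb H_{\mathcal U}$ is the Hausdorff completion of the space of weakly null sequences in $H$ with respect to the semi-inner product $\lim_{n,\mathcal U}\langle x_n,y_n\rangle$, and $\gamma_{\mathcal U}:\mathcal Q(H)\to\mathcal B(\mathbb H_{\mathcal U})$ is the representation determined by $\gamma_{\mathcal U}(\pi(S))[(x_n)]=[(Sx_n)]$. -/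

import Mathlib

open Filter Topology
open scoped NNReal

noncomputable section

/-! ### The Calkin algebra -/

section CalkinAlgebra

theorem norm_adjoint_apply_sq_le {H : Type*} [NormedAddCommGroup H] [InnerProductSpace ℂ H]
    [CompleteSpace H] (T : H →L[ℂ] H) (z : H) :
    ‖ContinuousLinearMap.adjoint T z‖ ^ 2 ≤ ‖T (ContinuousLinearMap.adjoint T z)‖ * ‖z‖ := by
  have h3 : inner ℂ (ContinuousLinearMap.adjoint T z) (ContinuousLinearMap.adjoint T z)
      = inner ℂ (T (ContinuousLinearMap.adjoint T z)) z :=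
    ContinuousLinearMap.adjoint_inner_right T _ _
  have h4 := norm_inner_le_norm (𝕜 := ℂ) (T (ContinuousLinearMap.adjoint T z)) z
  rw [← h3] at h4
  refine le_trans ?_ h4
  rw [norm_sq_eq_re_inner (𝕜 := ℂ)]
  exact RCLike.re_le_norm _

/-- The adjoint of a compact operator on a Hilbert space is compact. -/
theorem isCompactOperator_adjoint {H : Type*} [NormedAddCommGroup H] [InnerProductSpace ℂ H]
    [CompleteSpace H] {T : H →L[ℂ] H} (hT : IsCompactOperator T) :
    IsCompactOperator (ContinuousLinearMap.adjoint T) := by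
  have hTS := norm_adjoint_apply_sq_le T
  generalize ContinuousLinearMap.adjoint T = S at *
  have htb : TotallyBounded ((T.comp S) '' Metric.closedBall 0 1) :=
    ((IsCompactOperator.isCompact_closure_image_closedBall
      (f := ((T.comp S : H →L[ℂ] H) : H →ₗ[ℂ] H))
      (hT.comp_clm S) 1).totallyBounded).subset subset_closure
  have key : TotallyBounded (S '' Metric.closedBall 0 1) := by
    rw [Metric.totallyBounded_iff]
    intro ε hε
    obtain ⟨t, hts, htf, htc⟩ := Metric.finite_approx_of_totallyBounded htb (ε ^ 2 / 4)
      (by positivity)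
    have hts' : ∀ y ∈ t, ∃ x, x ∈ Metric.closedBall (0 : H) 1 ∧ T (S x) = y := fun y hy => hts hy
    choose! g hg using hts'
    refine ⟨(fun y => S (g y)) '' t, htf.image _, ?_⟩
    rintro _ ⟨x, hx, rfl⟩
    obtain ⟨y, hy, hxy⟩ := Set.mem_iUnion₂.1 (htc ⟨x, hx, rfl⟩)
    refine Set.mem_iUnion₂.2 ⟨S (g y), ⟨y, hy, rfl⟩, ?_⟩
    have hgy := hg y hy
    rw [Metric.mem_ball, dist_eq_norm] at hxy ⊢
    rw [← hgy.2] at hxy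
    rw [← map_sub]
    have h1 : ‖x - g y‖ ≤ 2 := by
      have a := mem_closedBall_zero_iff.1 hx
      have b := mem_closedBall_zero_iff.1 hgy.1
      linarith [norm_sub_le x (g y)]
    have h2 := hTS (x - g y)
    have h5 : ‖T (S (x - g y))‖ < ε ^ 2 / 4 := by
      rw [map_sub, map_sub]
      exact hxy
    have h6 : ‖T (S (x - g y))‖ * ‖x - g y‖ ≤ ‖T (S (x - g y))‖ * 2 :=
      mul_le_mul_of_nonneg_left h1 (norm_nonneg _)
    refine lt_of_pow_lt_pow_left₀ 2 hε.le ?_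
    have h7 : 0 < ε ^ 2 := by positivity
    linarith
  change IsCompactOperator (S : H →ₗ[ℂ] H)
  rw [isCompactOperator_iff_isCompact_closure_image_closedBall (S : H →ₗ[ℂ] H) zero_lt_one]
  exact key.closure.isCompact_of_isClosed isClosed_closure

variable (H : Type*) [NormedAddCommGroup H] [InnerProductSpace ℂ H] [CompleteSpace H]

/-- The ideal `𝓚(H)` of compact operators on `H`. -/
def compactIdeal : Ideal (H →L[ℂ] H) where
  carrier := {T | IsCompactOperator T}
  add_mem' hS hT := IsCompactOperator.add hS hT
  zero_mem' := isCompactOperator_zero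
  smul_mem' S _ hT := IsCompactOperator.clm_comp hT S

instance compactIdeal_isTwoSided : (compactIdeal H).IsTwoSided where
  mul_mem_of_left S hT := IsCompactOperator.comp_clm hT S

/-- The Calkin algebra `𝓠(H) = 𝓑(H) / 𝓚(H)`. -/
abbrev Calkin : Type _ := (H →L[ℂ] H) ⧸ compactIdeal H

/-- The quotient map `π : 𝓑(H) → 𝓠(H)`. -/
abbrev calkinMk : (H →L[ℂ] H) →+* Calkin H := Ideal.Quotient.mk (compactIdeal H)

/-- The adjoint of the Calkin algebra, `π(T)* = π(T*)`. -/
instance calkinStar : Star (Calkin H) where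
  star := Quotient.map' (s₁ := Submodule.quotientRel (compactIdeal H))
    (s₂ := Submodule.quotientRel (compactIdeal H)) star (by
      intro S T h
      rw [Submodule.quotientRel_def] at h ⊢
      rw [← star_sub]
      exact isCompactOperator_adjoint h)

theorem calkinMk_star (T : H →L[ℂ] H) : calkinMk H (star T) = star (calkinMk H T) := rfl

instance calkinStarRing : StarRing (Calkin H) where
  star_involutive q := by
    obtain ⟨T, rfl⟩ := Ideal.Quotient.mk_surjective q
    rw [← calkinMk_star, ← calkinMk_star, star_star]
  star_mul p q := by
    obtain ⟨S, rfl⟩ := Ideal.Quotient.mk_surjective p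
    obtain ⟨T, rfl⟩ := Ideal.Quotient.mk_surjective q
    rw [← map_mul, ← calkinMk_star, ← calkinMk_star, ← calkinMk_star, star_mul, map_mul]
  star_add p q := by
    obtain ⟨S, rfl⟩ := Ideal.Quotient.mk_surjective p
    obtain ⟨T, rfl⟩ := Ideal.Quotient.mk_surjective q
    rw [← map_add, ← calkinMk_star, ← calkinMk_star, ← calkinMk_star, star_add, map_add]

end CalkinAlgebra

/-! ### Calkin representations -/

section CalkinRepresentation

variable (H : Type*) [NormedAddCommGroup H] [InnerProductSpace ℂ H]

/-- The weakly null sequences in `H`. -/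
def weaklyNull : Submodule ℂ (ℕ → H) where
  carrier := {x | ∀ y : H, Tendsto (fun n => inner ℂ y (x n)) atTop (𝓝 0)}
  add_mem' {a b} ha hb y := by
    simpa [inner_add_right] using (ha y).add (hb y)
  zero_mem' y := by simp
  smul_mem' c x hx y := by
    simpa [inner_smul_right] using (hx y).const_mul c

variable {H} in
theorem weaklyNull_bounded [CompleteSpace H] {x : ℕ → H} (hx : x ∈ weaklyNull H) :
    ∃ C, ∀ n, ‖x n‖ ≤ C := by
  obtain ⟨C, hC⟩ := banach_steinhaus (g := fun n => innerSL ℂ (x n)) (by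
    intro y
    obtain ⟨C, hC⟩ := (hx y).norm.bddAbove_range
    refine ⟨C, fun n => ?_⟩
    rw [innerSL_apply_apply, norm_inner_symm]
    exact hC ⟨n, rfl⟩)
  exact ⟨C, fun n => by simpa using hC n⟩

variable {H} in
/-- The pairing `LIM_{n,𝓤} ⟨x_n, y_n⟩`. -/
def ultraInner (𝓤 : Ultrafilter ℕ) (x y : ℕ → H) : ℂ :=
  limUnder (𝓤 : Filter ℕ) (fun n => inner ℂ (x n) (y n))

variable {H} in
theorem tendsto_ultraInner [CompleteSpace H] (𝓤 : Ultrafilter ℕ) {x y : ℕ → H}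
    (hx : x ∈ weaklyNull H) (hy : y ∈ weaklyNull H) :
    Tendsto (fun n => inner ℂ (x n) (y n)) (𝓤 : Filter ℕ) (𝓝 (ultraInner 𝓤 x y)) := by
  obtain ⟨C, hC⟩ := weaklyNull_bounded hx
  obtain ⟨D, hD⟩ := weaklyNull_bounded hy
  apply tendsto_nhds_limUnder
  have hK := isCompact_closedBall (0 : ℂ) (C * D)
  obtain ⟨z, -, hz⟩ := isCompact_iff_ultrafilter_le_nhds.1 hK
    (𝓤.map fun n => inner ℂ (x n) (y n)) (by
      rw [le_principal_iff]
      refine Filter.Eventually.of_forall (f := (𝓤 : Filter ℕ)) fun n => ?_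
      simp only [Metric.mem_closedBall, dist_zero_right]
      exact (norm_inner_le_norm _ _).trans
        (mul_le_mul (hC n) (hD n) (norm_nonneg _) ((norm_nonneg _).trans (hC n))))
  exact ⟨z, hz⟩

/-- A copy of the space of weakly null sequences in `H`, to carry the semi-inner product
determined by the ultrafilter `𝓤`. -/
def UltraSeq (_ : Ultrafilter ℕ) : Type _ := weaklyNull H

variable (𝓤 : Ultrafilter ℕ)

instance : AddCommGroup (UltraSeq H 𝓤) := inferInstanceAs (AddCommGroup (weaklyNull H))

instance : Module ℂ (UltraSeq H 𝓤) := inferInstanceAs (Module ℂ (weaklyNull H))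

variable [CompleteSpace H]

/-- The semi-inner product `⟨x, y⟩ = LIM_{n,𝓤} ⟨x_n, y_n⟩` on weakly null sequences. -/
abbrev ultraSeqCore : PreInnerProductSpace.Core ℂ (UltraSeq H 𝓤) where
  inner x y := ultraInner 𝓤 x.1 y.1
  conj_inner_symm x y := by
    refine tendsto_nhds_unique
      ((Complex.continuous_conj.tendsto _).comp (tendsto_ultraInner 𝓤 y.2 x.2)) ?_
    refine (tendsto_ultraInner 𝓤 x.2 y.2).congr fun n => ?_
    simp
  re_inner_nonneg x := by
    refine ge_of_tendsto ((Complex.continuous_re.tendsto _).comp (tendsto_ultraInner 𝓤 x.2 x.2))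
      (Eventually.of_forall fun n => ?_)
    exact inner_self_nonneg (𝕜 := ℂ)
  add_left x y z := by
    refine tendsto_nhds_unique (tendsto_ultraInner 𝓤 (x + y).2 z.2) ?_
    refine ((tendsto_ultraInner 𝓤 x.2 z.2).add (tendsto_ultraInner 𝓤 y.2 z.2)).congr fun n => ?_
    exact (inner_add_left _ _ _).symm
  smul_left x y r := by
    refine tendsto_nhds_unique (tendsto_ultraInner 𝓤 (r • x).2 y.2) ?_
    refine ((tendsto_ultraInner 𝓤 x.2 y.2).const_mul _).congr fun n => ?_
    exact (inner_smul_left _ _ _).symm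

instance : SeminormedAddCommGroup (UltraSeq H 𝓤) :=
  InnerProductSpace.Core.toSeminormedAddCommGroup (c := ultraSeqCore H 𝓤)

instance : InnerProductSpace ℂ (UltraSeq H 𝓤) := InnerProductSpace.ofCore (ultraSeqCore H 𝓤)

/-- The Hilbert space `ℍ` of the `𝓤`-Calkin representation. The (Hausdorff) completion identifies
weakly null sequences `x`, `y` with `lim_{n,𝓤} ‖x_n - y_n‖ = 0`. -/
abbrev CalkinSpace : Type _ := UniformSpace.Completion (UltraSeq H 𝓤)

variable {H}

theorem ultraSeq_tendsto_norm_sq (x : UltraSeq H 𝓤) :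
    Tendsto (fun n => ‖x.1 n‖ ^ 2) (𝓤 : Filter ℕ) (𝓝 (‖x‖ ^ 2)) := by
  have h := (Complex.continuous_re.tendsto _).comp (tendsto_ultraInner 𝓤 x.2 x.2)
  have h2 : ‖x‖ ^ 2 = (ultraInner 𝓤 x.1 x.1).re := norm_sq_eq_re_inner (𝕜 := ℂ) x
  rw [h2]
  refine h.congr fun n => ?_
  exact (norm_sq_eq_re_inner (𝕜 := ℂ) (x.1 n)).symm

theorem map_mem_weaklyNull (T : H →L[ℂ] H) {x : ℕ → H} (hx : x ∈ weaklyNull H) :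
    (fun n => T (x n)) ∈ weaklyNull H := by
  intro y
  refine (hx (ContinuousLinearMap.adjoint T y)).congr fun n => ?_
  exact ContinuousLinearMap.adjoint_inner_left T _ _

/-- The operator `Φ₀(T) : (x_n) ↦ (T x_n)` on weakly null sequences. -/
def calkinΦ₀ (T : H →L[ℂ] H) : UltraSeq H 𝓤 →L[ℂ] UltraSeq H 𝓤 :=
  LinearMap.mkContinuous
    { toFun := fun x => ⟨fun n => T (x.1 n), map_mem_weaklyNull T x.2⟩
      map_add' := fun x y => Subtype.ext (funext fun n => map_add T (x.1 n) (y.1 n))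
      map_smul' := fun c x => Subtype.ext (funext fun n => map_smul T c (x.1 n)) }
    ‖T‖ (by
      intro x
      refine (sq_le_sq₀ (norm_nonneg _) (by positivity)).1 ?_
      rw [mul_pow]
      refine le_of_tendsto_of_tendsto' (ultraSeq_tendsto_norm_sq 𝓤 _)
        ((ultraSeq_tendsto_norm_sq 𝓤 x).const_mul _) fun n => ?_
      rw [← mul_pow]
      exact pow_le_pow_left₀ (norm_nonneg _) (T.le_opNorm _) 2)

/-- The representation `Φ : 𝓑(H) → 𝓑(ℍ)`, where `Φ(T)` is the continuous extension of `Φ₀(T)`. -/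
def calkinΦ : (H →L[ℂ] H) →+* (CalkinSpace H 𝓤 →L[ℂ] CalkinSpace H 𝓤) where
  toFun T := (calkinΦ₀ 𝓤 T).completion
  map_one' := by
    ext x
    induction x using UniformSpace.Completion.induction_on with
    | hp => exact isClosed_eq (by fun_prop) (by fun_prop)
    | ih x => simp; rfl
  map_mul' S T := by
    ext x
    induction x using UniformSpace.Completion.induction_on with
    | hp => exact isClosed_eq (by fun_prop) (by fun_prop)
    | ih x => simp; rfl
  map_zero' := by
    ext x
    induction x using UniformSpace.Completion.induction_on with
    | hp => exact isClosed_eq (by fun_prop) (by fun_prop)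
    | ih x => simp; rfl
  map_add' S T := by
    ext x
    induction x using UniformSpace.Completion.induction_on with
    | hp => exact isClosed_eq (by fun_prop) (by fun_prop)
    | ih x => simp [← UniformSpace.Completion.coe_add]; rfl

/-- A compact operator maps weakly null sequences to norm null sequences. -/
theorem tendsto_zero_of_isCompactOperator {K : H →L[ℂ] H} (hK : IsCompactOperator K)
    {x : ℕ → H} (hx : x ∈ weaklyNull H) : Tendsto (fun n => K (x n)) atTop (𝓝 0) := by
  obtain ⟨C, hC⟩ := weaklyNull_bounded hx
  have hc := hK.isCompact_closure_image_closedBall C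
  refine tendsto_of_subseq_tendsto fun ns hns => ?_
  obtain ⟨z, -, φ, hφ, hz⟩ := hc.tendsto_subseq (x := fun k => K (x (ns k)))
    (fun k => subset_closure ⟨x (ns k), mem_closedBall_zero_iff.2 (hC _), rfl⟩)
  refine ⟨φ, ?_⟩
  have hz0 : z = 0 := by
    have h1 := (map_mem_weaklyNull K hx z).comp (hns.comp hφ.tendsto_atTop)
    have h2 : Tendsto (fun k => inner ℂ z (K (x (ns (φ k))))) atTop (𝓝 (inner ℂ z z)) :=
      tendsto_const_nhds.inner hz
    exact inner_self_eq_zero.1 (tendsto_nhds_unique h2 h1)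
  rw [hz0] at hz
  exact hz

/-- The `𝓤`-Calkin representation `γ : 𝓠(H) → 𝓑(ℍ)`, `γ(π(T)) = Φ(T)`, for a nonprincipal
ultrafilter `𝓤` on `ℕ`. -/
def calkinRep (h𝓤 : (𝓤 : Filter ℕ) ≤ cofinite) :
    Calkin H →+* (CalkinSpace H 𝓤 →L[ℂ] CalkinSpace H 𝓤) :=
  Ideal.Quotient.lift (compactIdeal H) (calkinΦ 𝓤) (by
    intro K hK
    ext x
    induction x using UniformSpace.Completion.induction_on with
    | hp => exact isClosed_eq (by fun_prop) (by fun_prop)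
    | ih x =>
      have h1 : (calkinΦ 𝓤 K) (x : CalkinSpace H 𝓤)
          = ((calkinΦ₀ 𝓤 K x : UltraSeq H 𝓤) : CalkinSpace H 𝓤) :=
        ContinuousLinearMap.completion_apply_coe _ _
      have h2 : ‖calkinΦ₀ 𝓤 K x‖ ^ 2 = 0 := by
        refine tendsto_nhds_unique (ultraSeq_tendsto_norm_sq 𝓤 (calkinΦ₀ 𝓤 K x)) ?_
        have h3 := ((tendsto_zero_of_isCompactOperator hK x.2).norm.pow 2).mono_left
          (h𝓤.trans Nat.cofinite_eq_atTop.le)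
        simpa using! h3
      rw [h1]
      refine norm_eq_zero.1 ?_
      rw [UniformSpace.Completion.norm_coe]
      simpa using h2)

end CalkinRepresentation

/-! ### Admissible spaces -/

section Admissible

/-- The compact sets `X_N = closure (exp (2⁻ᴺ Z))`. -/
def expLevel (Z : Set ℂ) (N : ℕ) : Set ℂ := closure ((fun z => Complex.exp (z / 2 ^ N)) '' Z)

/-- The inverse limit of the sets `X_N` under the maps `z ↦ z ^ 2`, with the topology of
coordinatewise convergence. -/
abbrev AdmissibleSpace (Z : Set ℂ) : Type :=
  {x : ℕ → ℂ // ∀ N, x N ∈ expLevel Z N ∧ x (N + 1) ^ 2 = x N}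

/-- The coordinate projection `π_N`, as an element of `C(X)`. -/
def coordProj (Z : Set ℂ) (N : ℕ) : C(AdmissibleSpace Z, ℂ) where
  toFun ξ := ξ.1 N
  continuous_toFun := (continuous_apply N).comp continuous_subtype_val

/-- The points of `B` whose antipode also belongs to `B`. -/
def antipodalSet (B : Set ℂ) : Set ℂ := {z | z ∈ B ∧ -z ∈ B}

end Admissible

/-! ### Extensions -/

section Extensions

/-- A Busby invariant: a unital `*`-monomorphism `τ : C(X) → 𝓠(H)`. -/
structure BusbyInvariant (X : Type*) [TopologicalSpace X] (H : Type*) [NormedAddCommGroup H]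
    [InnerProductSpace ℂ H] [CompleteSpace H] where
  toHom : C(X, ℂ) →⋆ₐ[ℂ] Calkin H
  injective : Function.Injective toHom

variable {X : Type*} [TopologicalSpace X] {H : Type*} [NormedAddCommGroup H]
    [InnerProductSpace ℂ H] [CompleteSpace H]

/-- Equivalence of extensions: `τ₂ = π(U)* τ₁ π(U)` for some unitary `U ∈ 𝓑(H)`. -/
def BusbyInvariant.Equivalent (τ₁ τ₂ : BusbyInvariant X H) : Prop :=
  ∃ U ∈ unitary (H →L[ℂ] H), ∀ g : C(X, ℂ),
    τ₂.toHom g = star (calkinMk H U) * τ₁.toHom g * calkinMk H U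

/-- `τ` has the form `g ↦ π(⨁ᵢ g(ξᵢ) Iᵢ)`, where `H = ⨁ᵢ Hᵢ` is an orthogonal decomposition into
infinite-dimensional closed subspaces, `Iᵢ` is the identity of `Hᵢ`, and `(ξᵢ)` is dense in `X`. -/
def BusbyInvariant.IsDiagonal (τ : BusbyInvariant X H) : Prop :=
  ∃ (V : ℕ → Submodule ℂ H) (ξ : ℕ → X),
    (∀ i, IsClosed (V i : Set H)) ∧ (∀ i, ¬ FiniteDimensional ℂ (V i)) ∧
    (∀ i j, i ≠ j → ∀ x ∈ V i, ∀ y ∈ V j, inner ℂ x y = 0) ∧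
    (⨆ i, V i).topologicalClosure = ⊤ ∧
    DenseRange ξ ∧
    ∀ g : C(X, ℂ), ∃ T : H →L[ℂ] H,
      (∀ i, ∀ x ∈ V i, T x = g (ξ i) • x) ∧ τ.toHom g = calkinMk H T

/-- `τ` represents the zero element `Θ` of `Ext(X)`. -/
def BusbyInvariant.IsZero (τ : BusbyInvariant X H) : Prop :=
  ∃ τ₀ : BusbyInvariant X H, τ₀.IsDiagonal ∧ τ₀.Equivalent τ

end Extensions

/-! ### Dyadic semigroups -/

section Semigroups

/-- The positive dyadic rationals. -/
abbrev PosDyadic : Type := {t : ℝ≥0 // ∃ k m : ℕ, 0 < k ∧ t = k / 2 ^ m}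

/-- For a sequence with `a (n + 1) ^ 2 = a n`, the dyadic semigroup extending `2⁻ⁿ ↦ a n`, that is
`k / 2 ^ m ↦ a m ^ k`; it is independent of the representation of the dyadic number, see
`dyadicSemigroup_div`. -/
def dyadicSemigroup {A : Type*} [Monoid A] (a : ℕ → A) (t : PosDyadic) : A :=
  a t.2.choose_spec.choose ^ t.2.choose

theorem pow_two_pow_of_sq {A : Type*} [Monoid A] {a : ℕ → A} (ha : ∀ n, a (n + 1) ^ 2 = a n)
    (m d : ℕ) : a (m + d) ^ 2 ^ d = a m := by
  induction d with
  | zero => simp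
  | succ d ih => rw [← add_assoc, pow_succ', pow_mul, ha, ih]

theorem dyadicSemigroup_div {A : Type*} [Monoid A] {a : ℕ → A} (ha : ∀ n, a (n + 1) ^ 2 = a n)
    (t : PosDyadic) (k m : ℕ) (h : (t : ℝ≥0) = k / 2 ^ m) : dyadicSemigroup a t = a m ^ k := by
  obtain ⟨-, h2⟩ := t.2.choose_spec.choose_spec
  unfold dyadicSemigroup
  generalize t.2.choose_spec.choose = m' at *
  generalize t.2.choose = k' at *
  rw [h, div_eq_div_iff (by positivity) (by positivity)] at h2
  have h3 : k * 2 ^ m' = k' * 2 ^ m := by exact_mod_cast h2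
  rw [← pow_two_pow_of_sq ha m m', ← pow_two_pow_of_sq ha m' m, ← pow_mul, ← pow_mul,
    add_comm m' m, mul_comm _ k, mul_comm _ k', h3]

/-- The dyadic semigroup induced by an extension of an admissible space: the one with
`q(2⁻ⁿ) = τ(π_n)`. -/
def inducedSemigroup {H : Type*} [NormedAddCommGroup H] [InnerProductSpace ℂ H] [CompleteSpace H]
    {Z : Set ℂ} (τ : BusbyInvariant (AdmissibleSpace Z) H) : PosDyadic → Calkin H :=
  dyadicSemigroup fun n => τ.toHom (coordProj Z n)

theorem inducedSemigroup_div {H : Type*} [NormedAddCommGroup H] [InnerProductSpace ℂ H]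
    [CompleteSpace H] {Z : Set ℂ} (τ : BusbyInvariant (AdmissibleSpace Z) H)
    (t : PosDyadic) (k m : ℕ) (h : (t : ℝ≥0) = k / 2 ^ m) :
    inducedSemigroup τ t = τ.toHom (coordProj Z m) ^ k := by
  refine dyadicSemigroup_div (fun n => ?_) t k m h
  rw [← map_pow]
  congr 1
  ext ξ
  exact (ξ.2 n).2

/-- `C₀`-semigroups of bounded operators. -/
structure IsC0Semigroup {E : Type*} [NormedAddCommGroup E] [NormedSpace ℂ E]
    (T : ℝ≥0 → E →L[ℂ] E) : Prop where
  map_zero : T 0 = 1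
  map_add : ∀ s t, T (s + t) = T s * T t
  continuous : ∀ x, Continuous fun t => T t x

/-- A dyadic semigroup in `𝓠(H)` is a `C₀`-semigroup with respect to the `𝓤`-Calkin
representation `γ` if `γ(q(t))` extends to a `C₀`-semigroup on `ℍ` defined for all `t ≥ 0`. -/
def IsC0InCalkinRep {H : Type*} [NormedAddCommGroup H] [InnerProductSpace ℂ H] [CompleteSpace H]
    (𝓤 : Ultrafilter ℕ) (h𝓤 : (𝓤 : Filter ℕ) ≤ cofinite) (q : PosDyadic → Calkin H) : Prop :=
  ∃ T : ℝ≥0 → CalkinSpace H 𝓤 →L[ℂ] CalkinSpace H 𝓤,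
    IsC0Semigroup T ∧ ∀ t : PosDyadic, T t = calkinRep 𝓤 h𝓤 (q t)

/-- Uniform continuity of a dyadic semigroup: `‖q(t) - 1‖ → 0` as `t → 0`, in the quotient norm
of `𝓠(H)`. -/
def IsUniformlyContinuousSemigroup {H : Type*} [NormedAddCommGroup H] [InnerProductSpace ℂ H]
    [CompleteSpace H] (q : PosDyadic → Calkin H) : Prop :=
  Tendsto (fun t => ‖q t - 1‖) (comap (fun t : PosDyadic => (t : ℝ≥0)) (𝓝 0)) (𝓝 0)

end Semigroups

/-! ### The set `Z` -/

section Example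

/-- `α_j = π / j + 2 ^ (n_j + 1) π`. -/
def angleα (n : ℕ → ℕ) (j : ℕ) : ℝ := Real.pi / j + 2 ^ (n j + 1) * Real.pi

/-- `β_j = π / j + 3 · 2 ^ n_j π`. -/
def angleβ (n : ℕ → ℕ) (j : ℕ) : ℝ := Real.pi / j + 3 * 2 ^ n j * Real.pi

/-- `Z = {i α_j} ∪ {i β_j}`, where `j` ranges over the primes `j ≥ 3`. -/
def primeSet (n : ℕ → ℕ) : Set ℂ :=
  {z | ∃ j : ℕ, j.Prime ∧ 3 ≤ j ∧ z = Complex.I * (angleα n j : ℂ)} ∪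
    {z | ∃ j : ℕ, j.Prime ∧ 3 ≤ j ∧ z = Complex.I * (angleβ n j : ℂ)}

end Example

end

/-!
The points of `Z`, together with `0`, are the numbers `i π (1 / j + a)` for certain labels `(j, a)`
with `a` a natural number, where the label `(0, 0)` belongs to `0`. Since `n_j → ∞`, at each level
`N` all but finitely many labels have `a` divisible by `2 ^ (N + 1)`, and for these, if `j ≠ 0`,
`exp (2⁻ᴺ z) = exp (i π / (j 2 ^ N))`. So the points accumulate only at `1`, the point with label
`(0, 0)`, and every point of `X_N` has a label (`exists_label_of_mem_expLevel`). Reciprocals `1 / j`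
of distinct integers `j ≥ 2` are neither integers nor congruent modulo `1`, so coinciding or
antipodal points of a level share `j` (`IsLabel.eq_of_angle_sub`). For antipodal points the two
values of `a` then differ by `± 2 ^ n_j`, an odd multiple of `2 ^ N` exactly when `n_j = N`. Along a
point of the inverse limit `j` is constant, so that its coordinates are `exp (i y_N / 2 ^ N)` with
`y_N` bounded, which gives the pointwise convergence, not only for `π_N` but for all dyadic powers
`π_m ^ k`, as `k / 2 ^ m → 0` (`exists_norm_coordProj_pow_sub_one_le`). At level `N = n_j` the point
over `i β_j` has a coordinate in the left half plane, which excludes uniform convergence.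

For the semigroup, a Busby invariant followed by a Calkin representation is a `*`-representation `R`
of `C(X)` on a Hilbert space. The functionals `f ↦ ⟨x, R(f) x⟩` are positive, hence given by finite
measures, and `‖R(g) x‖² = ∫ |g|² dμ`; dominated convergence turns bounded pointwise convergence
into strong convergence (`tendsto_starAlgHom_apply_zero`). So the orbits of the dyadic semigroup are
uniformly continuous and extend to all `t ≥ 0` (`exists_isC0Semigroup_extension`). This holds for
every extension. The zero class enters in the norm estimate `‖τ(g)‖ ≥ |g(p)|`
(`BusbyInvariant.IsZero.norm_apply_le`): a representative of `τ(g)` of norm less than `|g(ξ_i)|`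
would make a compact operator bounded below on the infinite-dimensional space `H_i`. Hence
`‖q(2⁻ᴺ) - 1‖ ≥ 1` for infinitely many `N`. Diagonal extensions exist: the rows of a Hilbert basis
indexed by `ℕ × ℕ` serve as the spaces `H_i`.
-/

noncomputable section

/-! ### Angles and labels -/

/-- The angle `π (1 / j + a)`. At `j = 0` the convention `0⁻¹ = 0` makes it `π a`, so that the
label `(0, 0)` stands for the limit point `1` of every level. -/
def labelAngle (j a : ℕ) : ℝ := Real.pi * ((j : ℝ)⁻¹ + a)

/-- The labels `(j, a)` with `Z ∪ {0} = {i π (1 / j + a)}`. -/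
def IsLabel (n : ℕ → ℕ) (j a : ℕ) : Prop :=
  (j = 0 ∧ a = 0) ∨ (j.Prime ∧ 3 ≤ j ∧ (a = 2 ^ (n j + 1) ∨ a = 3 * 2 ^ n j))

theorem angleα_eq_labelAngle (n : ℕ → ℕ) (j : ℕ) :
    angleα n j = labelAngle j (2 ^ (n j + 1)) := by
  simp only [angleα, labelAngle]; push_cast; ring

theorem angleβ_eq_labelAngle (n : ℕ → ℕ) (j : ℕ) :
    angleβ n j = labelAngle j (3 * 2 ^ n j) := by
  simp only [angleβ, labelAngle]; push_cast; ring

theorem mem_primeSet_iff (n : ℕ → ℕ) (z : ℂ) : z ∈ primeSet n ↔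
    ∃ j a, IsLabel n j a ∧ j ≠ 0 ∧ z = Complex.I * (labelAngle j a : ℂ) := by
  constructor
  · rintro (⟨j, hp, h3, rfl⟩ | ⟨j, hp, h3, rfl⟩)
    · exact ⟨j, _, Or.inr ⟨hp, h3, Or.inl rfl⟩, by omega, by rw [angleα_eq_labelAngle]⟩
    · exact ⟨j, _, Or.inr ⟨hp, h3, Or.inr rfl⟩, by omega, by rw [angleβ_eq_labelAngle]⟩
  · rintro ⟨j, a, ⟨h0, -⟩ | ⟨hp, h3, rfl | rfl⟩, hj, rfl⟩
    · exact absurd h0 hj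
    · exact Or.inl ⟨j, hp, h3, by rw [angleα_eq_labelAngle]⟩
    · exact Or.inr ⟨j, hp, h3, by rw [angleβ_eq_labelAngle]⟩

theorem IsLabel.inv_mem {n : ℕ → ℕ} {j a : ℕ} (h : IsLabel n j a) :
    0 ≤ (j : ℝ)⁻¹ ∧ (j : ℝ)⁻¹ < 1 := by
  refine ⟨by positivity, ?_⟩
  rcases h with ⟨rfl, -⟩ | ⟨-, h3, -⟩
  · simp
  · exact inv_lt_one_of_one_lt₀ (by exact_mod_cast (by omega : 1 < j))

/-- Distinct reciprocals `1 / j` are incongruent modulo `1`, hence two label angles differing by an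
integer multiple of `π` have the same `j`. -/
theorem IsLabel.eq_of_angle_sub {n : ℕ → ℕ} {j a k b : ℕ} (h : IsLabel n j a)
    (h' : IsLabel n k b) {m : ℤ} (he : labelAngle j a = labelAngle k b + Real.pi * m) :
    j = k ∧ (a : ℤ) = b + m := by
  have h1 : (j : ℝ)⁻¹ + a = (k : ℝ)⁻¹ + b + m := by
    apply mul_left_cancel₀ Real.pi_ne_zero
    simp only [labelAngle] at he
    linarith
  obtain ⟨j0, j1⟩ := h.inv_mem
  obtain ⟨k0, k1⟩ := h'.inv_mem
  have h2 : (j : ℝ)⁻¹ - (k : ℝ)⁻¹ = ((b + m - a : ℤ) : ℝ) := by push_cast; linarith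
  have h3 : (b + m - a : ℤ) = 0 := by
    have l1 : ((b + m - a : ℤ) : ℝ) < ((1 : ℤ) : ℝ) := by
      rw [← h2]; push_cast; linarith
    have l2 : ((-1 : ℤ) : ℝ) < ((b + m - a : ℤ) : ℝ) := by
      rw [← h2]; push_cast; linarith
    have := Int.cast_lt.1 l1
    have := Int.cast_lt.1 l2
    omega
  refine ⟨?_, by omega⟩
  rw [h3, Int.cast_zero, sub_eq_zero] at h2
  exact_mod_cast inv_injective h2

/-- The point of the `N`-th level with label `(j, a)`. -/
def levelPoint (N j a : ℕ) : ℂ := Complex.exp (Complex.I * (labelAngle j a : ℂ) / 2 ^ N)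

theorem levelPoint_succ_sq (N j a : ℕ) : levelPoint (N + 1) j a ^ 2 = levelPoint N j a := by
  rw [levelPoint, levelPoint, ← Complex.exp_nat_mul]
  congr 1
  rw [pow_succ]
  push_cast
  field_simp

theorem norm_levelPoint (N j a : ℕ) : ‖levelPoint N j a‖ = 1 := by
  rw [levelPoint]
  have : Complex.I * (labelAngle j a : ℂ) / 2 ^ N
      = ((labelAngle j a / 2 ^ N : ℝ) : ℂ) * Complex.I := by push_cast; ring
  rw [this, Complex.norm_exp_ofReal_mul_I]

theorem labelAngle_sub_of_exp_eq {N j a k b : ℕ} (c : ℤ)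
    (h : levelPoint N j a = Complex.exp (Complex.I * (labelAngle k b : ℂ) / 2 ^ N
      + Real.pi * Complex.I * c)) :
    ∃ m : ℤ, labelAngle j a = labelAngle k b
      + Real.pi * (((2 * m + c) * 2 ^ N : ℤ) : ℝ) := by
  obtain ⟨m, hm⟩ := Complex.exp_eq_exp_iff_exists_int.1 h
  refine ⟨m, ?_⟩
  have h2 : (2 : ℂ) ^ N ≠ 0 := pow_ne_zero _ two_ne_zero
  have h3 : Complex.I * (labelAngle j a : ℂ) = Complex.I * ((labelAngle k b
      + Real.pi * (((2 * m + c) * 2 ^ N : ℤ) : ℝ) : ℝ) : ℂ) := by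
    field_simp at hm
    push_cast
    rw [hm]
    ring
  exact_mod_cast mul_left_cancel₀ Complex.I_ne_zero h3

theorem IsLabel.eq_of_levelPoint_eq {n : ℕ → ℕ} {N j a k b : ℕ} (h : IsLabel n j a)
    (h' : IsLabel n k b) (he : levelPoint N j a = levelPoint N k b) : j = k := by
  obtain ⟨m, hm⟩ := labelAngle_sub_of_exp_eq (N := N) (j := j) (a := a) (k := k) (b := b) 0
    (by simpa [levelPoint] using he)
  exact (h.eq_of_angle_sub h' hm).1

/-- Antipodal label points share `j`, and their labels differ by an odd multiple of `2 ^ N`. -/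
theorem IsLabel.of_levelPoint_eq_neg {n : ℕ → ℕ} {N j a k b : ℕ} (h : IsLabel n j a)
    (h' : IsLabel n k b) (he : levelPoint N j a = -levelPoint N k b) :
    j = k ∧ ∃ m : ℤ, (a : ℤ) = b + (2 * m + 1) * 2 ^ N := by
  obtain ⟨m, hm⟩ := labelAngle_sub_of_exp_eq (N := N) (j := j) (a := a) (k := k) (b := b) 1
    (by rw [he, levelPoint, Complex.exp_add]; simp [Complex.exp_pi_mul_I])
  exact ⟨(h.eq_of_angle_sub h' hm).1, m, (h.eq_of_angle_sub h' hm).2⟩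

/-- The two points with first label `j` are antipodal at the level `n j`. -/
theorem levelPoint_antipodal (n : ℕ → ℕ) (j : ℕ) :
    levelPoint (n j) j (3 * 2 ^ n j) = -levelPoint (n j) j (2 ^ (n j + 1)) := by
  have h : Complex.I * (labelAngle j (3 * 2 ^ n j) : ℂ) / 2 ^ n j
      = Complex.I * (labelAngle j (2 ^ (n j + 1)) : ℂ) / 2 ^ n j + Real.pi * Complex.I := by
    simp only [labelAngle]
    push_cast
    field_simp
    ring
  rw [levelPoint, h, Complex.exp_add, Complex.exp_pi_mul_I, levelPoint]
  ring

/-! ### The set `Z` and its levels -/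

theorem natCast_le_labelAngle {j a m : ℕ} (h : m ≤ a) : (m : ℝ) ≤ labelAngle j a := by
  have h1 : (m : ℝ) ≤ a := by exact_mod_cast h
  have h2 : (0 : ℝ) ≤ (j : ℝ)⁻¹ := by positivity
  rw [labelAngle]
  nlinarith [Real.pi_gt_three, Nat.cast_nonneg (α := ℝ) m]

theorem isClosed_image_labelAngle {n a : ℕ → ℕ} (hn : Tendsto n atTop atTop)
    (ha : ∀ j, n j ≤ a j) (S : Set ℕ) :
    IsClosed ((fun j => Complex.I * (labelAngle j (a j) : ℂ)) '' S) := by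
  have h1 : Tendsto (fun j => Complex.I * (labelAngle j (a j) : ℂ)) atTop (cocompact ℂ) := by
    rw [← Metric.cobounded_eq_cocompact, ← comap_norm_atTop, tendsto_comap_iff]
    refine tendsto_atTop_mono (fun j => ?_) (tendsto_natCast_atTop_atTop.comp hn)
    simpa using (natCast_le_labelAngle (j := j) (ha j)).trans (le_abs_self _)
  rw [← Nat.cofinite_eq_atTop, ← cocompact_eq_cofinite] at h1
  exact (isProperMap_iff_tendsto_cocompact.2
    ⟨continuous_of_discreteTopology, h1⟩).isClosedMap S (isClosed_discrete S)

theorem le_two_pow_succ (m : ℕ) : m ≤ 2 ^ (m + 1) :=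
  (Nat.lt_two_pow_self).le.trans (Nat.pow_le_pow_right (by norm_num) (by omega))

theorem le_three_mul_two_pow (m : ℕ) : m ≤ 3 * 2 ^ m :=
  (Nat.lt_two_pow_self).le.trans (Nat.le_mul_of_pos_left _ (by norm_num))

theorem isClosed_primeSet {n : ℕ → ℕ} (hn : Tendsto n atTop atTop) : IsClosed (primeSet n) := by
  have h := (isClosed_image_labelAngle hn (fun j => le_two_pow_succ (n j))
    {j | j.Prime ∧ 3 ≤ j}).union
    (isClosed_image_labelAngle hn (fun j => le_three_mul_two_pow (n j)) {j | j.Prime ∧ 3 ≤ j})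
  convert h using 1
  ext z
  simp only [primeSet, Set.mem_union, Set.mem_ofPred_eq, Set.mem_image, angleα_eq_labelAngle,
    angleβ_eq_labelAngle, and_assoc, eq_comm (a := z)]

theorem levelPoint_mem_expLevel {n : ℕ → ℕ} (N : ℕ) {j a : ℕ} (h : IsLabel n j a) (hj : j ≠ 0) :
    levelPoint N j a ∈ expLevel (primeSet n) N :=
  subset_closure ⟨_, (mem_primeSet_iff n _).2 ⟨j, a, h, hj, rfl⟩, rfl⟩

/-- If `2 ^ (N + 1)` eventually divides the integral part of the label, that part does not
contribute to the point at level `N`, and the points tend to `1`. -/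
theorem tendsto_levelPoint {N : ℕ} {a : ℕ → ℕ} (ha : ∀ᶠ j in atTop, 2 ^ (N + 1) ∣ a j) :
    Tendsto (fun j => levelPoint N j (a j)) atTop (𝓝 1) := by
  have h1 : Tendsto (fun j : ℕ => Complex.exp (Complex.I * ((Real.pi * (j : ℝ)⁻¹ : ℝ) : ℂ) / 2 ^ N))
      atTop (𝓝 1) := by
    have h0 : Tendsto (fun j : ℕ => Real.pi * (j : ℝ)⁻¹) atTop (𝓝 0) := by
      simpa using (tendsto_inv_atTop_zero.comp tendsto_natCast_atTop_atTop).const_mul Real.pi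
    have hc : Continuous fun y : ℝ => Complex.exp (Complex.I * (y : ℂ) / 2 ^ N) := by fun_prop
    have := (hc.tendsto 0).comp h0
    simpa only [Complex.ofReal_zero, mul_zero, zero_div, Complex.exp_zero] using! this
  refine h1.congr' ?_
  filter_upwards [ha] with j hj
  obtain ⟨c, hc⟩ := hj
  rw [levelPoint, Complex.exp_eq_exp_iff_exists_int]
  refine ⟨-c, ?_⟩
  rw [labelAngle, hc]
  push_cast
  rw [pow_succ]
  field_simp
  ring

/-- Every point of the `N`-th level has a label: beyond the points `exp (2⁻ᴺ z)`, `z ∈ Z`, only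
the limit point `1` occurs. -/
theorem exists_label_of_mem_expLevel {n : ℕ → ℕ} (hn : Tendsto n atTop atTop) {N : ℕ} {w : ℂ}
    (hw : w ∈ expLevel (primeSet n) N) : ∃ j a, IsLabel n j a ∧ w = levelPoint N j a := by
  classical
  -- Fill the gaps between the primes with the value `1` to get convergent sequences.
  have key : ∀ a : ℕ → ℕ, (∀ᶠ j in atTop, 2 ^ (N + 1) ∣ a j) → IsClosed (insert (1 : ℂ)
      (Set.range fun j => if j.Prime ∧ 3 ≤ j then levelPoint N j (a j) else 1)) := by
    intro a ha
    refine (Tendsto.isCompact_insert_range ?_).isClosed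
    exact Tendsto.if' (tendsto_levelPoint ha) tendsto_const_nhds
  have hN := hn.eventually_ge_atTop (N + 1)
  have hc := (key (fun j => 2 ^ (n j + 1)) (hN.mono fun j hj => pow_dvd_pow 2 (by omega))).union
    (key (fun j => 3 * 2 ^ n j) (hN.mono fun j hj => (pow_dvd_pow 2 hj).mul_left 3))
  have h1 : ∃ j a, IsLabel n j a ∧ (1 : ℂ) = levelPoint N j a :=
    ⟨0, 0, Or.inl ⟨rfl, rfl⟩, by simp [levelPoint, labelAngle]⟩
  have hsub := closure_minimal (s := (fun z => Complex.exp (z / 2 ^ N)) '' primeSet n) ?_ hc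
  · rcases hsub hw with (rfl | ⟨j, rfl⟩) | (rfl | ⟨j, rfl⟩)
    · exact h1
    · dsimp only
      split_ifs with h
      · exact ⟨j, _, Or.inr ⟨h.1, h.2, Or.inl rfl⟩, rfl⟩
      · exact h1
    · exact h1
    · dsimp only
      split_ifs with h
      · exact ⟨j, _, Or.inr ⟨h.1, h.2, Or.inr rfl⟩, rfl⟩
      · exact h1
  · rintro _ ⟨z, hz, rfl⟩
    obtain ⟨j, a, ⟨h0, -⟩ | ⟨hp, h3, rfl | rfl⟩, hj, rfl⟩ := (mem_primeSet_iff n z).1 hz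
    · exact absurd h0 hj
    · exact Or.inl (Or.inr ⟨j, by simp only [hp, h3, and_self, if_true]; rfl⟩)
    · exact Or.inr (Or.inr ⟨j, by simp only [hp, h3, and_self, if_true]; rfl⟩)

theorem antipodalSet_expLevel_primeSet {n : ℕ → ℕ} (hn : Tendsto n atTop atTop) (N : ℕ) :
    antipodalSet (expLevel (primeSet n) N) =
      {w | ∃ j : ℕ, j.Prime ∧ 3 ≤ j ∧ n j = N ∧
        (w = Complex.exp (Complex.I * (angleα n j : ℂ) / 2 ^ N) ∨
          w = -Complex.exp (Complex.I * (angleα n j : ℂ) / 2 ^ N))} := by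
  simp only [angleα_eq_labelAngle]
  refine Set.ext fun w => ⟨?_, ?_⟩
  · rintro ⟨hw, hw'⟩
    obtain ⟨j, a, h, rfl⟩ := exists_label_of_mem_expLevel hn hw
    obtain ⟨k, b, h', he⟩ := exists_label_of_mem_expLevel hn hw'
    obtain ⟨rfl, m, hm⟩ := h.of_levelPoint_eq_neg h' (by rw [← he, neg_neg])
    have hodd : (2 * m + 1) * 2 ^ N ≠ 0 := by
      have : (2 : ℤ) ^ N ≠ 0 := by positivity
      have : 2 * m + 1 ≠ 0 := by omega
      positivity
    -- Labels with the same `j` differ by `0` or `± 2 ^ n j`.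
    have hpow : ∀ {c : ℤ}, (2 : ℤ) ^ n j = (2 * c + 1) * 2 ^ N → n j = N := by
      intro c hc
      rcases lt_trichotomy (n j) N with hlt | heq | hgt
      · obtain ⟨d, hd⟩ := Nat.exists_eq_add_of_lt hlt
        rw [hd, pow_add, pow_succ, pow_add] at hc
        have h1 : (1 : ℤ) = (2 * c + 1) * 2 ^ d * 2 := by
          apply mul_left_cancel₀ (pow_ne_zero (n j) (two_ne_zero (α := ℤ)))
          linarith
        omega
      · exact heq
      · obtain ⟨d, hd⟩ := Nat.exists_eq_add_of_lt hgt
        rw [hd, pow_add, pow_succ, pow_add] at hc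
        have h1 : (2 : ℤ) ^ d * 2 = 2 * c + 1 := by
          apply mul_left_cancel₀ (pow_ne_zero N (two_ne_zero (α := ℤ)))
          linarith
        omega
    rcases h with ⟨h0, ha⟩ | ⟨hp, h3, ha⟩
    · rcases h' with ⟨-, hb⟩ | ⟨hp, h3, -⟩
      · subst ha hb; simp at hm; omega
      · omega
    · rcases h' with ⟨h0, -⟩ | ⟨-, -, hb⟩
      · omega
      · rcases ha with rfl | rfl <;> rcases hb with rfl | rfl
        · exact absurd (by linarith) hodd
        · have hj : n j = N := hpow (c := -m - 1) (by
            push_cast at hm; rw [pow_succ] at hm; linarith)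
          exact ⟨j, hp, h3, hj, Or.inl rfl⟩
        · have hj : n j = N := hpow (c := m) (by push_cast at hm; rw [pow_succ] at hm; linarith)
          refine ⟨j, hp, h3, hj, Or.inr ?_⟩
          rw [← hj, levelPoint_antipodal, levelPoint]
        · exact absurd (by linarith) hodd
  · rintro ⟨j, hp, h3, rfl, h⟩
    have hα := levelPoint_mem_expLevel (n := n) (n j) (Or.inr ⟨hp, h3, Or.inl rfl⟩) (by omega)
    have hβ := levelPoint_mem_expLevel (n := n) (n j) (Or.inr ⟨hp, h3, Or.inr rfl⟩) (by omega)
    rw [levelPoint_antipodal] at hβ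
    rcases h with rfl | rfl
    · exact ⟨hα, hβ⟩
    · exact ⟨hβ, by rwa [neg_neg]⟩

/-! ### The inverse limit -/

theorem norm_coordProj_apply {n : ℕ → ℕ} (hn : Tendsto n atTop atTop) (N : ℕ)
    (ξ : AdmissibleSpace (primeSet n)) : ‖coordProj (primeSet n) N ξ‖ = 1 := by
  obtain ⟨j, a, -, h⟩ := exists_label_of_mem_expLevel hn (ξ.2 N).1
  exact (congrArg norm h).trans (norm_levelPoint N j a)

/-- The coordinates of a point of `X` all have the same first label `j`, so that they lift to
angles bounded independently of the level. -/
theorem exists_bounded_lift {n : ℕ → ℕ} (hn : Tendsto n atTop atTop)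
    (ξ : AdmissibleSpace (primeSet n)) : ∃ C : ℝ, ∀ N, ∃ y : ℝ, |y| ≤ C ∧
      coordProj (primeSet n) N ξ = Complex.exp (Complex.I * (y : ℂ) / 2 ^ N) := by
  choose j a hl he using fun N => exists_label_of_mem_expLevel hn (ξ.2 N).1
  have hj : ∀ N, j N = j 0 := by
    intro N
    induction N with
    | zero => rfl
    | succ N ih =>
      rw [← ih]
      refine (hl (N + 1)).eq_of_levelPoint_eq (hl N) (N := N) ?_
      rw [← levelPoint_succ_sq, ← he, ← he, (ξ.2 N).2]
  have ha : ∀ N, a N ≤ 3 * 2 ^ n (j 0) := by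
    intro N
    rcases hl N with ⟨-, h⟩ | ⟨-, -, h | h⟩
    · rw [h]; positivity
    · rw [h, hj, pow_succ]; omega
    · rw [h, hj]
  refine ⟨labelAngle (j 0) (3 * 2 ^ n (j 0)), fun N => ⟨labelAngle (j N) (a N), ?_, he N⟩⟩
  rw [abs_of_nonneg (by rw [labelAngle]; positivity), hj, labelAngle, labelAngle]
  gcongr
  exact ha N

/-- The dyadic powers `ξ_m ^ k`, as functions of `t = k / 2 ^ m`, are Lipschitz at `0`. -/
theorem exists_norm_coordProj_pow_sub_one_le {n : ℕ → ℕ} (hn : Tendsto n atTop atTop)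
    (ξ : AdmissibleSpace (primeSet n)) : ∃ C : ℝ, ∀ k m : ℕ,
      ‖coordProj (primeSet n) m ξ ^ k - 1‖ ≤ C * (k / 2 ^ m) := by
  obtain ⟨C, hC⟩ := exists_bounded_lift hn ξ
  refine ⟨C, fun k m => ?_⟩
  obtain ⟨y, hy, h⟩ := hC m
  have h1 : (k : ℂ) * (Complex.I * (y : ℂ) / 2 ^ m)
      = Complex.I * ((y * (k / 2 ^ m) : ℝ) : ℂ) := by push_cast; ring
  rw [h, ← Complex.exp_nat_mul, h1]
  refine Real.norm_exp_I_mul_ofReal_sub_one_le.trans ?_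
  rw [Real.norm_eq_abs, abs_mul, abs_of_nonneg (by positivity : (0 : ℝ) ≤ k / 2 ^ m)]
  gcongr

theorem tendsto_coordProj {n : ℕ → ℕ} (hn : Tendsto n atTop atTop)
    (ξ : AdmissibleSpace (primeSet n)) :
    Tendsto (fun N => coordProj (primeSet n) N ξ) atTop (𝓝 1) := by
  obtain ⟨C, hC⟩ := exists_norm_coordProj_pow_sub_one_le hn ξ
  rw [tendsto_iff_norm_sub_tendsto_zero]
  refine squeeze_zero (fun _ => norm_nonneg _) (fun N => by simpa using hC 1 N) ?_
  simpa using (tendsto_inv_atTop_zero.comp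
    (tendsto_pow_atTop_atTop_of_one_lt (one_lt_two (α := ℝ)))).const_mul C

/-- The point of `X` with the constant label `(j, a)`. -/
def labelPoint {n : ℕ → ℕ} {j a : ℕ} (h : IsLabel n j a) (hj : j ≠ 0) :
    AdmissibleSpace (primeSet n) :=
  ⟨fun N => levelPoint N j a, fun N => ⟨levelPoint_mem_expLevel N h hj, levelPoint_succ_sq N j a⟩⟩

instance nonempty_admissibleSpace_primeSet (n : ℕ → ℕ) :
    Nonempty (AdmissibleSpace (primeSet n)) :=
  ⟨labelPoint (Or.inr ⟨Nat.prime_three, le_rfl, Or.inl rfl⟩) three_ne_zero⟩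

/-- At the level `N = n j` the point of `X` over `i β_j` has a coordinate in the left half plane,
close to `-1`. -/
theorem exists_one_le_norm_coordProj_sub_one {n : ℕ → ℕ} (hn : Tendsto n atTop atTop) (N₀ : ℕ) :
    ∃ N ≥ N₀, ∃ ξ, 1 ≤ ‖coordProj (primeSet n) N ξ - 1‖ := by
  obtain ⟨J, hJ⟩ := eventually_atTop.1 (hn.eventually_ge_atTop N₀)
  obtain ⟨j, hj, hp⟩ := Nat.exists_infinite_primes (max J 3)
  have h3 : 3 ≤ j := le_of_max_le_right hj
  refine ⟨n j, hJ j (le_of_max_le_left hj),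
    labelPoint (Or.inr ⟨hp, h3, Or.inr rfl⟩) (by omega), ?_⟩
  change 1 ≤ ‖levelPoint (n j) j (3 * 2 ^ n j) - 1‖
  have h1 : levelPoint (n j) j (3 * 2 ^ n j)
      = -Complex.exp (((Real.pi / (j * 2 ^ n j) : ℝ) : ℂ) * Complex.I) := by
    rw [levelPoint_antipodal, levelPoint, neg_inj, Complex.exp_eq_exp_iff_exists_int]
    refine ⟨1, ?_⟩
    rw [labelAngle]
    have : (j : ℂ) ≠ 0 := by exact_mod_cast (by omega : j ≠ 0)
    push_cast
    rw [pow_succ]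
    field_simp
  have h2 : 0 ≤ Real.cos (Real.pi / (j * 2 ^ n j)) := by
    have hb : (2 : ℝ) ≤ j * 2 ^ n j := by
      have : (2 : ℝ) ≤ j := by exact_mod_cast (by omega : 2 ≤ j)
      have : (1 : ℝ) ≤ 2 ^ n j := one_le_pow₀ one_le_two
      nlinarith
    have hnn : 0 ≤ Real.pi / (j * 2 ^ n j) := by positivity
    refine Real.cos_nonneg_of_mem_Icc ⟨by linarith [Real.pi_pos], ?_⟩
    exact div_le_div_of_nonneg_left Real.pi_pos.le two_pos hb
  refine le_trans ?_ (Complex.abs_re_le_norm _)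
  rw [h1, Complex.sub_re, Complex.neg_re, Complex.exp_ofReal_mul_I_re, Complex.one_re]
  rw [abs_of_nonpos (by linarith)]
  linarith

theorem not_tendstoUniformly_coordProj {n : ℕ → ℕ} (hn : Tendsto n atTop atTop) :
    ¬ TendstoUniformly (fun (N : ℕ) (ξ : AdmissibleSpace (primeSet n)) =>
      coordProj (primeSet n) N ξ) (fun _ => 1) atTop := by
  intro h
  obtain ⟨N₀, hN₀⟩ := eventually_atTop.1 (Metric.tendstoUniformly_iff.1 h 1 one_pos)
  obtain ⟨N, hN, ξ, hξ⟩ := exists_one_le_norm_coordProj_sub_one hn N₀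
  have := hN₀ N hN ξ
  rw [dist_comm, dist_eq_norm] at this
  linarith

theorem isCompact_expLevel {n : ℕ → ℕ} (hn : Tendsto n atTop atTop) (N : ℕ) :
    IsCompact (expLevel (primeSet n) N) := by
  refine Metric.isCompact_of_isClosed_isBounded isClosed_closure
    ((Metric.isBounded_iff_subset_closedBall 0).2 ⟨1, fun w hw => ?_⟩)
  obtain ⟨j, a, -, rfl⟩ := exists_label_of_mem_expLevel hn hw
  simp [norm_levelPoint]

theorem compactSpace_admissibleSpace {n : ℕ → ℕ} (hn : Tendsto n atTop atTop) :
    CompactSpace (AdmissibleSpace (primeSet n)) := by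
  suffices h : IsCompact {x : ℕ → ℂ |
      ∀ N, x N ∈ expLevel (primeSet n) N ∧ x (N + 1) ^ 2 = x N} from
    isCompact_iff_compactSpace.1 h
  refine (isCompact_univ_pi fun N => isCompact_expLevel hn N).of_isClosed_subset ?_
    fun x hx N _ => (hx N).1
  simp only [Set.ofPred_forall, Set.ofPred_and]
  refine isClosed_iInter fun N => (isClosed_closure.preimage (continuous_apply N)).inter ?_
  exact isClosed_eq ((continuous_apply (N + 1)).pow 2) (continuous_apply N)

/-! ### Representations of `C(X)` and pointwise convergence -/

section PointwiseConvergence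

variable {X : Type*} [TopologicalSpace X]
  {E : Type*} [NormedAddCommGroup E] [InnerProductSpace ℂ E] [CompleteSpace E]

/-- A real-valued continuous function as a complex-valued one. -/
def complexify (f : C(X, ℝ)) : C(X, ℂ) := ⟨fun ξ => (f ξ : ℂ), by fun_prop⟩

theorem norm_sq_starAlgHom_apply (R : C(X, ℂ) →⋆ₐ[ℂ] (E →L[ℂ] E)) (g : C(X, ℂ)) (x : E) :
    ‖R g x‖ ^ 2 = (inner ℂ x (R (star g * g) x)).re := by
  rw [map_mul, map_star, ContinuousLinearMap.star_eq_adjoint, mul_apply_eq_comp,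
    ContinuousLinearMap.adjoint_inner_right]
  exact norm_sq_eq_re_inner (𝕜 := ℂ) _

/-- The positive functional `f ↦ ⟨x, R(f) x⟩` on real-valued functions. -/
def vectorFunctional [CompactSpace X] (R : C(X, ℂ) →⋆ₐ[ℂ] (E →L[ℂ] E)) (x : E) :
    CompactlySupportedContinuousMap X ℝ →ₚ[ℝ] ℝ :=
  PositiveLinearMap.mk₀
    { toFun := fun f => (inner ℂ x (R (complexify f) x)).re
      map_add' := fun f g => by
        have : complexify ((f + g : CompactlySupportedContinuousMap X ℝ) : C(X, ℝ))
            = complexify f + complexify g := by ext ξ; simp [complexify]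
        rw [this, map_add, add_apply, inner_add_right, Complex.add_re]
      map_smul' := fun c f => by
        have : complexify ((c • f : CompactlySupportedContinuousMap X ℝ) : C(X, ℝ))
            = (c : ℂ) • complexify f := by ext ξ; simp [complexify]
        rw [this, map_smul, smul_apply, inner_smul_right,
          Complex.re_ofReal_mul]
        rfl }
    (by
      intro f hf
      -- A nonnegative function is the square of its square root.
      let s : C(X, ℝ) := ⟨fun ξ => √(f ξ), by fun_prop⟩
      have : complexify (f : C(X, ℝ)) = star (complexify s) * complexify s := by
        ext ξ
        have h0 : (0 : ℝ) ≤ f ξ := hf ξ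
        simp only [complexify, s, ContinuousMap.coe_mk, ContinuousMap.mul_apply,
          ContinuousMap.star_apply, Complex.star_def, Complex.conj_ofReal]
        rw [← Complex.ofReal_mul, Real.mul_self_sqrt h0]
      change 0 ≤ (inner ℂ x (R (complexify (f : C(X, ℝ))) x)).re
      rw [this, ← norm_sq_starAlgHom_apply]
      positivity)

/-- The spectral measure of a vector: `‖R(g) x‖² = ∫ |g|² dμ`. -/
theorem exists_measure_norm_sq_eq_integral [CompactSpace X] [T2Space X]
    [MeasurableSpace X] [BorelSpace X]
    (R : C(X, ℂ) →⋆ₐ[ℂ] (E →L[ℂ] E)) (x : E) :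
    ∃ μ : MeasureTheory.Measure X, MeasureTheory.IsFiniteMeasure μ ∧
      ∀ g : C(X, ℂ), ‖R g x‖ ^ 2 = ∫ ξ, ‖g ξ‖ ^ 2 ∂μ := by
  refine ⟨RealRMK.rieszMeasure (vectorFunctional R x), inferInstance, fun g => ?_⟩
  let f : C(X, ℝ) := ⟨fun ξ => ‖g ξ‖ ^ 2, by fun_prop⟩
  have h := RealRMK.integral_rieszMeasure (vectorFunctional R x)
    (CompactlySupportedContinuousMap.continuousMapEquiv f)
  have hf : star g * g = complexify f := by
    ext ξ
    simp [complexify, f, Complex.conj_mul']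
  rw [norm_sq_starAlgHom_apply, hf]
  exact h.symm

/-- Dominated convergence for representations: bounded pointwise null families of functions are
represented by families of operators converging strongly to zero. -/
theorem tendsto_starAlgHom_apply_zero [CompactSpace X] [T2Space X]
    (R : C(X, ℂ) →⋆ₐ[ℂ] (E →L[ℂ] E)) {ι : Type*} {l : Filter ι} [l.IsCountablyGenerated] {f : ι → C(X, ℂ)} {C : ℝ}
    (hC : ∀ i ξ, ‖f i ξ‖ ≤ C) (hf : ∀ ξ, Tendsto (fun i => f i ξ) l (𝓝 0)) (x : E) :
    Tendsto (fun i => R (f i) x) l (𝓝 0) := by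
  borelize X
  obtain ⟨μ, hμ, hx⟩ := exists_measure_norm_sq_eq_integral R x
  have h1 : Tendsto (fun i => ∫ ξ, ‖f i ξ‖ ^ 2 ∂μ) l (𝓝 (∫ _, (0 : ℝ) ∂μ)) := by
    refine MeasureTheory.tendsto_integral_filter_of_dominated_convergence (fun _ => C ^ 2)
      (Eventually.of_forall fun i => ?_) (Eventually.of_forall fun i =>
        Eventually.of_forall fun ξ => ?_) (MeasureTheory.integrable_const _)
      (Eventually.of_forall fun ξ => ?_)
    · exact Continuous.aestronglyMeasurable (by fun_prop)
    · rw [Real.norm_of_nonneg (by positivity)]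
      exact pow_le_pow_left₀ (norm_nonneg _) (hC i ξ) 2
    · simpa using ((hf ξ).norm.pow 2)
  simp only [← hx, MeasureTheory.integral_zero] at h1
  rw [tendsto_zero_iff_norm_tendsto_zero]
  simpa [Real.sqrt_sq (norm_nonneg _)] using h1.sqrt

theorem norm_starAlgHom_le_one_of_norm_eq_one (R : C(X, ℂ) →⋆ₐ[ℂ] (E →L[ℂ] E)) {g : C(X, ℂ)}
    (hg : ∀ ξ, ‖g ξ‖ = 1) : ‖R g‖ ≤ 1 := by
  refine ContinuousLinearMap.opNorm_le_bound _ zero_le_one fun x => ?_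
  have h1 : star g * g = 1 := by
    ext ξ
    simp [Complex.conj_mul', hg]
  have h2 := norm_sq_starAlgHom_apply R g x
  rw [h1, map_one, one_apply_eq_self] at h2
  have h3 : ‖R g x‖ ^ 2 = ‖x‖ ^ 2 := h2.trans (norm_sq_eq_re_inner (𝕜 := ℂ) x).symm
  rw [one_mul]
  exact ((pow_left_inj₀ (norm_nonneg _) (norm_nonneg _) two_ne_zero).1 h3).le

end PointwiseConvergence

/-! ### Calkin representations preserve adjoints -/

section CalkinStar

variable {H : Type*} [NormedAddCommGroup H] [InnerProductSpace ℂ H] [CompleteSpace H]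
  (𝓤 : Ultrafilter ℕ)

theorem calkinΦ_coe (T : H →L[ℂ] H) (x : UltraSeq H 𝓤) :
    calkinΦ 𝓤 T (x : CalkinSpace H 𝓤) = ((calkinΦ₀ 𝓤 T x : UltraSeq H 𝓤) : CalkinSpace H 𝓤) :=
  ContinuousLinearMap.completion_apply_coe _ _

theorem calkinΦ_star (T : H →L[ℂ] H) : calkinΦ 𝓤 (star T) = star (calkinΦ 𝓤 T) := by
  rw [ContinuousLinearMap.star_eq_adjoint (calkinΦ 𝓤 T), ContinuousLinearMap.eq_adjoint_iff]
  intro x y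
  induction x, y using UniformSpace.Completion.induction_on₂ with
  | hp => exact isClosed_eq (by fun_prop) (by fun_prop)
  | ih x y =>
    rw [calkinΦ_coe, calkinΦ_coe, UniformSpace.Completion.inner_coe,
      UniformSpace.Completion.inner_coe]
    refine tendsto_nhds_unique (tendsto_ultraInner 𝓤 (calkinΦ₀ 𝓤 (star T) x).2 y.2) ?_
    refine (tendsto_ultraInner 𝓤 x.2 (calkinΦ₀ 𝓤 T y).2).congr fun n => ?_
    exact (ContinuousLinearMap.adjoint_inner_left T _ _).symm

theorem calkinΦ_algebraMap (c : ℂ) :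
    calkinΦ 𝓤 (algebraMap ℂ (H →L[ℂ] H) c) = algebraMap ℂ _ c := by
  ext x
  induction x using UniformSpace.Completion.induction_on with
  | hp => exact isClosed_eq (by fun_prop) (by fun_prop)
  | ih x =>
    rw [calkinΦ_coe]
    simp only [Algebra.algebraMap_eq_smul_one, smul_apply,
      one_apply_eq_self, ← UniformSpace.Completion.coe_smul]
    rfl

/-- The Calkin representation as a `*`-homomorphism of `C(X)`, after composition with a Busby
invariant. -/
def BusbyInvariant.rep {X : Type*} [TopologicalSpace X] (τ : BusbyInvariant X H)
    (h𝓤 : (𝓤 : Filter ℕ) ≤ cofinite) :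
    C(X, ℂ) →⋆ₐ[ℂ] (CalkinSpace H 𝓤 →L[ℂ] CalkinSpace H 𝓤) where
  toRingHom := (calkinRep 𝓤 h𝓤).comp (τ.toHom : C(X, ℂ) →+* Calkin H)
  commutes' c := by
    change calkinRep 𝓤 h𝓤 (τ.toHom (algebraMap ℂ _ c)) = _
    rw [AlgHomClass.commutes]
    exact calkinΦ_algebraMap 𝓤 c
  map_star' g := by
    change calkinRep 𝓤 h𝓤 (τ.toHom (star g)) = star (calkinRep 𝓤 h𝓤 (τ.toHom g))
    rw [map_star]
    obtain ⟨T, hT⟩ := Ideal.Quotient.mk_surjective (τ.toHom g)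
    rw [← hT, ← calkinMk_star]
    exact calkinΦ_star 𝓤 T

end CalkinStar

/-! ### Extending dyadic semigroups -/

section DyadicExtension

theorem denseRange_posDyadic : DenseRange (fun t : PosDyadic => (t : ℝ≥0)) := by
  refine dense_of_exists_between fun a b hab => ?_
  obtain ⟨m, hm⟩ := exists_pow_lt_of_lt_one (tsub_pos_of_lt hab) (by
    rw [← NNReal.coe_lt_coe]; norm_num : (2⁻¹ : ℝ≥0) < 1)
  have h2 : (0 : ℝ≥0) < 2 ^ m := by positivity
  refine ⟨(⌊a * 2 ^ m⌋₊ + 1 : ℕ) / 2 ^ m, ⟨⟨_, _, m, Nat.succ_pos _, rfl⟩, rfl⟩, ?_, ?_⟩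
  · rw [lt_div_iff₀ h2]
    exact_mod_cast Nat.lt_floor_add_one (a * 2 ^ m)
  · refine lt_of_le_of_lt ?_ (lt_tsub_iff_left.1 hm)
    rw [div_le_iff₀ h2, add_mul, ← mul_pow, inv_mul_cancel₀ two_ne_zero, one_pow]
    push_cast
    gcongr
    exact Nat.floor_le (by positivity)

theorem exists_posDyadic_add_eq {s t : PosDyadic} (h : (s : ℝ≥0) < t) :
    ∃ d : PosDyadic, (t : ℝ≥0) = s + d := by
  obtain ⟨k, m, hk, hs⟩ := s.2
  obtain ⟨k', m', hk', ht⟩ := t.2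
  have hs' : (s : ℝ≥0) = (k * 2 ^ m' : ℕ) / 2 ^ (m + m') := by
    rw [hs, pow_add]; push_cast; field_simp
  have ht' : (t : ℝ≥0) = (k' * 2 ^ m : ℕ) / 2 ^ (m + m') := by
    rw [ht, pow_add]; push_cast; field_simp
  rw [hs', ht', div_lt_div_iff_of_pos_right (by positivity), Nat.cast_lt] at h
  refine ⟨⟨(k' * 2 ^ m - k * 2 ^ m' : ℕ) / 2 ^ (m + m'), _, _, tsub_pos_of_lt h, rfl⟩, ?_⟩
  rw [hs', ht', ← add_div, ← Nat.cast_add, Nat.add_sub_of_le h.le]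

variable {E : Type*} [NormedAddCommGroup E] [NormedSpace ℂ E] {Q : PosDyadic → E →L[ℂ] E}

/-- The orbits of a contractive dyadic semigroup which are continuous at zero are uniformly
continuous. -/
theorem uniformContinuous_orbit (hadd : ∀ s t u : PosDyadic, (u : ℝ≥0) = s + t → Q u = Q s * Q t)
    (hQ : ∀ t, ‖Q t‖ ≤ 1) {x : E}
    (h0 : Tendsto (fun t => Q t x) (comap (fun t : PosDyadic => (t : ℝ≥0)) (𝓝 0)) (𝓝 x)) :
    UniformContinuous fun t => Q t x := by
  rw [Metric.uniformContinuous_iff]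
  intro ε hε
  obtain ⟨U, hU, hUε⟩ := (Metric.tendsto_nhds.1 h0 ε hε).exists_mem
  obtain ⟨W, hW, hWU⟩ := hU
  obtain ⟨δ, hδ, hδW⟩ := Metric.mem_nhds_iff.1 hW
  have key : ∀ s t : PosDyadic, (s : ℝ≥0) < t → dist s t < δ → dist (Q t x) (Q s x) < ε := by
    intro s t hst hd
    obtain ⟨d, ht⟩ := exists_posDyadic_add_eq hst
    have hdd : dist (d : ℝ≥0) 0 < δ := by
      rw [dist_comm, Subtype.dist_eq, ht, NNReal.dist_eq] at hd
      rw [NNReal.dist_eq]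
      simpa using hd
    have h1 := hUε d (hWU (hδW hdd))
    rw [hadd s d t ht, mul_apply_eq_comp, dist_eq_norm, ← map_sub]
    rw [dist_eq_norm] at h1
    exact ((Q s).le_of_opNorm_le (hQ s) _).trans_lt (by simpa using h1)
  refine ⟨δ, hδ, fun {s t} hd => ?_⟩
  rcases lt_trichotomy (s : ℝ≥0) t with h | h | h
  · rw [dist_comm]; exact key s t h hd
  · rw [Subtype.ext h]; simpa using hε
  · exact key t s h (by rwa [dist_comm])

/-- A contractive dyadic semigroup, strongly continuous at zero, extends to a `C₀`-semigroup. -/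
theorem exists_isC0Semigroup_extension [CompleteSpace E]
    (hadd : ∀ s t u : PosDyadic, (u : ℝ≥0) = s + t → Q u = Q s * Q t) (hQ : ∀ t, ‖Q t‖ ≤ 1)
    (h0 : ∀ x, Tendsto (fun t => Q t x) (comap (fun t : PosDyadic => (t : ℝ≥0)) (𝓝 0)) (𝓝 x)) :
    ∃ T : ℝ≥0 → E →L[ℂ] E, IsC0Semigroup T ∧ ∀ t : PosDyadic, T t = Q t := by
  have hd := denseRange_posDyadic
  have hF : ∀ x, ∃ F : ℝ≥0 → E, Continuous F ∧ ∀ t : PosDyadic, F t = Q t x := by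
    intro x
    have hu := uniformContinuous_orbit hadd hQ (h0 x)
    have hi : IsUniformInducing (fun t : PosDyadic => (t : ℝ≥0)) := isUniformInducing_val _
    exact ⟨_, (uniformContinuous_uniformly_extend hi hd hu).continuous,
      fun t => uniformly_extend_of_ind hi hd hu t⟩
  choose F hFc hFQ using hF
  have heq : ∀ {f g : ℝ≥0 → E}, Continuous f → Continuous g →
      (∀ t : PosDyadic, f t = g t) → ∀ t, f t = g t :=
    fun hf hg h => congrFun (hd.equalizer hf hg (funext h))
  let T : ℝ≥0 → E →L[ℂ] E := fun t => LinearMap.mkContinuous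
    { toFun := fun x => F x t
      map_add' := fun x y => heq (hFc _) ((hFc x).add (hFc y)) (fun t => by simp [hFQ]) t
      map_smul' := fun c x => heq (hFc _) ((hFc x).const_smul c) (fun t => by simp [hFQ]) t }
    1 (fun x => by
      refine hd.induction_on (p := fun t => ‖F x t‖ ≤ 1 * ‖x‖) t
        (isClosed_le (hFc x).norm continuous_const) fun t => ?_
      rw [hFQ]
      exact (Q t).le_of_opNorm_le (hQ t) x)
  have hT : ∀ t x, T t x = F x t := fun t x => rfl
  refine ⟨T, ⟨?_, ?_, fun x => hFc x⟩, fun t => ContinuousLinearMap.ext fun x => hFQ x t⟩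
  · ext x
    have hne : (comap (fun t : PosDyadic => (t : ℝ≥0)) (𝓝 0)).NeBot :=
      (IsUniformInducing.isDenseInducing (isUniformInducing_val _) hd).comap_nhds_neBot 0
    have h1 : Tendsto (fun t : PosDyadic => F x t)
        (comap (fun t : PosDyadic => (t : ℝ≥0)) (𝓝 0)) (𝓝 (F x 0)) :=
      ((hFc x).tendsto 0).comp tendsto_comap
    simp only [hFQ] at h1
    exact tendsto_nhds_unique h1 (h0 x)
  · intro s t
    ext x
    have h1 : ∀ (s : PosDyadic) (t : ℝ≥0), F x (s + t) = Q s (F x t) := fun s =>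
      heq ((hFc x).comp (continuous_const_add _)) ((Q s).continuous.comp (hFc x)) fun t => by
        obtain ⟨k, m, hk, hs⟩ := s.2
        obtain ⟨k', m', hk', ht⟩ := t.2
        have hst : (s : ℝ≥0) + t = (k * 2 ^ m' + k' * 2 ^ m : ℕ) / 2 ^ (m + m') := by
          rw [hs, ht, pow_add]; push_cast; field_simp
        have h2 := hFQ x ⟨(s : ℝ≥0) + t, _, _, by positivity, hst⟩
        rw [hadd s t _ rfl] at h2
        rw [hFQ]
        exact h2
    change F x (s + t) = F (F x t) s
    exact heq ((hFc x).comp (continuous_add_const t)) (hFc _) (fun s => by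
      rw [hFQ]; exact h1 s t) s

end DyadicExtension

/-! ### Lower bounds in the Calkin algebra -/

section LowerBound

variable {H : Type*} [NormedAddCommGroup H] [InnerProductSpace ℂ H]

/-- A compact operator is bounded below only on finite-dimensional subspaces. -/
theorem finiteDimensional_of_le_norm_isCompactOperator [CompleteSpace H] {K : H →L[ℂ] H}
    (hK : IsCompactOperator K) {V : Submodule ℂ H} (hV : IsClosed (V : Set H)) {c : ℝ} (hc : 0 < c)
    (h : ∀ x ∈ V, c * ‖x‖ ≤ ‖K x‖) : FiniteDimensional ℂ V := by
  have : CompleteSpace V := hV.completeSpace_coe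
  let L : V →L[ℂ] H := K.comp V.subtypeL
  have hL : AntilipschitzWith (Real.toNNReal c⁻¹) L := by
    refine AddMonoidHomClass.antilipschitz_of_bound L fun x => ?_
    rw [Real.coe_toNNReal _ (by positivity), inv_mul_eq_div, le_div_iff₀ hc, mul_comm]
    exact h x x.2
  have hemb := hL.isClosedEmbedding L.uniformContinuous
  have hcomp : IsCompact (closure (K '' Metric.closedBall 0 1)) :=
    IsCompactOperator.isCompact_closure_image_closedBall (f := (K : H →ₗ[ℂ] H)) hK 1
  refine FiniteDimensional.of_isCompact_closedBall ℂ (r := 1) one_pos (c := (0 : V))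
    ((hemb.isCompact_preimage hcomp).of_isClosed_subset Metric.isClosed_closedBall fun x hx => ?_)
  exact subset_closure ⟨x, by simpa using hx, rfl⟩

variable [CompleteSpace H] {X : Type*} [TopologicalSpace X]

/-- Under an extension in the zero class no function becomes small: its values on the dense
sequence are eigenvalues of infinite multiplicity. -/
theorem BusbyInvariant.IsZero.norm_apply_le {τ : BusbyInvariant X H} (hτ : τ.IsZero) (g : C(X, ℂ))
    (p : X) : ‖g p‖ ≤ ‖τ.toHom g‖ := by
  obtain ⟨τ₀, ⟨V, ξ, hVc, hVd, -, -, hξ, hT⟩, U, hU, hτ⟩ := hτ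
  refine hξ.induction_on (p := fun p => ‖g p‖ ≤ ‖τ.toHom g‖) p
    (isClosed_le (by fun_prop) continuous_const) fun i => ?_
  by_contra! hlt
  obtain ⟨A, hA, hAlt⟩ := QuotientAddGroup.norm_lt_iff.1 hlt
  replace hA : calkinMk H A = τ.toHom g := hA
  obtain ⟨T, hTV, hTg⟩ := hT g
  have hUU : U * star U = 1 := Unitary.mul_star_self_of_mem hU
  have hK : IsCompactOperator (T - U * A * star U) := by
    suffices h : calkinMk H T = calkinMk H (U * A * star U) from Ideal.Quotient.eq.1 h
    rw [map_mul, map_mul, hA, hτ, hTg, ← calkinMk_star]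
    calc calkinMk H T
        = calkinMk H (U * star U) * calkinMk H T * calkinMk H (U * star U) := by
          rw [hUU, map_one, one_mul, mul_one]
      _ = _ := by simp only [map_mul, mul_assoc]
  refine hVd i (finiteDimensional_of_le_norm_isCompactOperator hK (hVc i)
    (c := ‖g (ξ i)‖ - ‖A‖) (sub_pos.2 hAlt) fun x hx => ?_)
  have hn1 : ‖U‖ ≤ 1 := by
    nontriviality H →L[ℂ] H
    exact (CStarRing.norm_of_mem_unitary hU).le
  have hn : ‖U * A * star U‖ ≤ ‖A‖ := by
    calc ‖U * A * star U‖ ≤ ‖U‖ * ‖A‖ * ‖star U‖ :=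
          (norm_mul_le _ _).trans (mul_le_mul_of_nonneg_right (norm_mul_le _ _) (norm_nonneg _))
      _ ≤ 1 * ‖A‖ * 1 := by rw [norm_star]; gcongr
      _ = ‖A‖ := by ring
  have h1 := (U * A * star U).le_of_opNorm_le hn x
  have h2 := norm_sub_norm_le (T x) ((U * A * star U) x)
  rw [hTV i x hx, norm_smul] at h2
  rw [sub_apply, hTV i x hx]
  linarith

end LowerBound

/-! ### Diagonal extensions -/

section Diagonal

variable {H : Type*} [NormedAddCommGroup H] [InnerProductSpace ℂ H]

theorem Orthonormal.countable_index [TopologicalSpace.SeparableSpace H] {ι : Type*} {v : ι → H}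
    (hv : Orthonormal ℂ v) : Countable ι := by
  refine Pairwise.countable_of_isOpen_disjoint (s := fun i => Metric.ball (v i) (1 / 2)) ?_
    (fun _ => Metric.isOpen_ball) fun i => ⟨v i, Metric.mem_ball_self (by norm_num)⟩
  intro i j hij
  refine Metric.ball_disjoint_ball ?_
  have h1 := norm_sub_sq (𝕜 := ℂ) (v i) (v j)
  rw [hv.2 hij, hv.1, hv.1] at h1
  simp only [map_zero, mul_zero, sub_zero] at h1
  rw [dist_eq_norm]
  nlinarith [norm_nonneg (v i - v j)]

theorem exists_hilbertBasis_nat_prod_nat [CompleteSpace H] [TopologicalSpace.SeparableSpace H]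
    (hH : ¬ FiniteDimensional ℂ H) : Nonempty (HilbertBasis (ℕ × ℕ) ℂ H) := by
  obtain ⟨w, b, -⟩ := exists_hilbertBasis ℂ H
  have : Countable w := b.orthonormal.countable_index
  have : Infinite w := by
    by_contra h
    rw [not_infinite_iff_finite] at h
    have := Fintype.ofFinite w
    exact hH (b.toOrthonormalBasis.toBasis.finiteDimensional_of_finite)
  obtain ⟨_⟩ := nonempty_denumerable w
  let e : ℕ × ℕ ≃ w := (Denumerable.eqv (ℕ × ℕ)).trans (Denumerable.eqv w).symm
  refine ⟨HilbertBasis.mk (b.orthonormal.comp e e.injective) ?_⟩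
  rw [e.surjective.range_comp, b.dense_span]

variable {ι : Type*} (b : HilbertBasis ι ℂ H) {X : Type*} [TopologicalSpace X] [CompactSpace X]
  (ξ : ι → X)

/-- The diagonal operator with entries `g (ξ i)` in the Hilbert basis `b`. -/
def diagonalOp (g : C(X, ℂ)) : H →L[ℂ] H :=
  (b.repr.symm : _ →L[ℂ] H) ∘L (lp.mapCLM 2 (fun i => g (ξ i) • ContinuousLinearMap.id ℂ ℂ)
    (norm_nonneg g) (fun i => by
      refine (norm_smul_le _ _).trans ?_
      rw [ContinuousLinearMap.norm_id, mul_one]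
      exact g.norm_coe_le_norm _)) ∘L (b.repr : H →L[ℂ] _)

theorem repr_diagonalOp (g : C(X, ℂ)) (x : H) (i : ι) :
    b.repr (diagonalOp b ξ g x) i = g (ξ i) * b.repr x i := by
  simp [diagonalOp, lp.mapCLM]

/-- The `*`-homomorphism `g ↦ ⨁ᵢ g(ξᵢ)`. -/
def diagonalHom [CompleteSpace H] : C(X, ℂ) →⋆ₐ[ℂ] (H →L[ℂ] H) where
  toFun := diagonalOp b ξ
  map_one' := by
    ext x; apply b.repr.injective; ext i
    simp [repr_diagonalOp]
  map_mul' g h := by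
    ext x; apply b.repr.injective; ext i
    simp [repr_diagonalOp, mul_assoc]
  map_zero' := by
    ext x; apply b.repr.injective; ext i
    simp [repr_diagonalOp]
  map_add' g h := by
    ext x; apply b.repr.injective; ext i
    simp [repr_diagonalOp, add_mul]
  commutes' c := by
    ext x; apply b.repr.injective; ext i
    simp [repr_diagonalOp, Algebra.algebraMap_eq_smul_one]
  map_star' g := by
    rw [ContinuousLinearMap.star_eq_adjoint, ContinuousLinearMap.eq_adjoint_iff]
    intro x y
    rw [← b.repr.inner_map_map, ← b.repr.inner_map_map, lp.inner_eq_tsum, lp.inner_eq_tsum]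
    refine tsum_congr fun i => ?_
    rw [repr_diagonalOp, repr_diagonalOp]
    simp only [ContinuousMap.star_apply, RCLike.inner_apply, map_mul, RCLike.star_def,
      RCLike.conj_conj]
    ring

/-- The closed subspace spanned by the basis vectors `b (i, k)`, `k ∈ ℕ`. -/
def rowSubspace (b : HilbertBasis (ℕ × ℕ) ℂ H) (i : ℕ) : Submodule ℂ H where
  carrier := {x | ∀ p : ℕ × ℕ, p.1 ≠ i → inner ℂ (b p) x = 0}
  add_mem' hx hy p hp := by rw [inner_add_right, hx p hp, hy p hp, add_zero]
  zero_mem' p _ := inner_zero_right _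
  smul_mem' c x hx p hp := by rw [inner_smul_right, hx p hp, mul_zero]

variable (b : HilbertBasis (ℕ × ℕ) ℂ H)

theorem basis_mem_rowSubspace (p : ℕ × ℕ) : b p ∈ rowSubspace b p.1 := fun _ hq =>
  b.orthonormal.2 fun h => hq (congrArg Prod.fst h)

theorem isClosed_rowSubspace (i : ℕ) : IsClosed (rowSubspace b i : Set H) := by
  have : (rowSubspace b i : Set H) = ⋂ (p : ℕ × ℕ) (_ : p.1 ≠ i), {x | inner ℂ (b p) x = 0} := by
    ext x; simp only [Set.mem_iInter]; rfl
  rw [this]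
  exact isClosed_iInter fun p => isClosed_iInter fun _ => isClosed_eq (by fun_prop) (by fun_prop)

theorem not_finiteDimensional_rowSubspace (i : ℕ) : ¬ FiniteDimensional ℂ (rowSubspace b i) := by
  intro h
  let v : ℕ → rowSubspace b i := fun k => ⟨b (i, k), basis_mem_rowSubspace b (i, k)⟩
  have hv : LinearIndependent ℂ v := by
    refine LinearIndependent.of_comp (rowSubspace b i).subtype ?_
    exact (b.orthonormal.comp (fun k => (i, k)) (Prod.mk_right_injective i)).linearIndependent
  have := hv.finite
  exact not_finite ℕ

theorem inner_rowSubspace_eq_zero {i j : ℕ} (hij : i ≠ j) {x y : H} (hx : x ∈ rowSubspace b i)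
    (hy : y ∈ rowSubspace b j) : inner ℂ x y = 0 := by
  rw [← b.tsum_inner_mul_inner, ← tsum_zero (α := ℂ) (β := ℕ × ℕ)]
  refine tsum_congr fun p => ?_
  by_cases hp : p.1 = i
  · rw [hy p (by omega), mul_zero]
  · rw [← inner_conj_symm, hx p hp, map_zero, zero_mul]

theorem topologicalClosure_iSup_rowSubspace : (⨆ i, rowSubspace b i).topologicalClosure = ⊤ := by
  rw [eq_top_iff, ← b.dense_span]
  refine Submodule.topologicalClosure_mono (Submodule.span_le.2 ?_)
  rintro _ ⟨p, rfl⟩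
  exact Submodule.mem_iSup_of_mem p.1 (basis_mem_rowSubspace b p)

theorem diagonalHom_apply_of_mem_rowSubspace [CompleteSpace H] (ζ : ℕ → X) (g : C(X, ℂ)) {i : ℕ}
    {x : H} (hx : x ∈ rowSubspace b i) :
    diagonalHom b (fun p => ζ p.1) g x = g (ζ i) • x := by
  apply b.repr.injective
  ext p
  change b.repr (diagonalOp b (fun p => ζ p.1) g x) p = _
  rw [repr_diagonalOp, map_smul, lp.coeFn_smul, Pi.smul_apply, smul_eq_mul]
  by_cases hp : p.1 = i
  · rw [hp]
  · rw [b.repr_apply_apply, hx p hp, mul_zero, mul_zero]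

/-- The diagonal extension given by a dense sequence, each point being repeated along one row of
the basis. It is injective: the identity of a row is not compact. -/
def diagonalExtension [CompleteSpace H] {ζ : ℕ → X} (hζ : DenseRange ζ) : BusbyInvariant X H where
  toHom :=
    { toRingHom := (calkinMk H).comp (diagonalHom b (fun p => ζ p.1) : C(X, ℂ) →+* (H →L[ℂ] H))
      commutes' := fun c =>
        congrArg (calkinMk H) (AlgHomClass.commutes (diagonalHom b (fun p => ζ p.1)) c)
      map_star' := fun g =>
        congrArg (calkinMk H) (map_star (diagonalHom b (fun p => ζ p.1)) g) }
  injective := by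
    intro g h hgh
    have hK : IsCompactOperator (diagonalHom b (fun p => ζ p.1) (g - h)) := by
      rw [map_sub]
      exact Ideal.Quotient.eq.1 hgh
    refine ContinuousMap.coe_injective (hζ.equalizer g.continuous h.continuous ?_)
    funext i
    by_contra hne
    refine not_finiteDimensional_rowSubspace b i (finiteDimensional_of_le_norm_isCompactOperator
      hK (isClosed_rowSubspace b i) (norm_pos_iff.2 (sub_ne_zero.2 hne)) fun x hx => ?_)
    rw [diagonalHom_apply_of_mem_rowSubspace b ζ _ hx, norm_smul]
    rfl

theorem isZero_diagonalExtension [CompleteSpace H] {ζ : ℕ → X} (hζ : DenseRange ζ) :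
    (diagonalExtension b hζ).IsZero := by
  refine ⟨diagonalExtension b hζ, ⟨rowSubspace b, ζ, isClosed_rowSubspace b,
    not_finiteDimensional_rowSubspace b,
    fun i j hij x hx y hy => inner_rowSubspace_eq_zero b hij hx hy,
    topologicalClosure_iSup_rowSubspace b, hζ, fun g => ⟨_, fun i x hx =>
      diagonalHom_apply_of_mem_rowSubspace b ζ g hx, rfl⟩⟩, 1, one_mem _, fun g => ?_⟩
  rw [map_one, star_one, one_mul, mul_one]

end Diagonal

/-! ### The induced dyadic semigroup -/

section InducedSemigroup

variable {n : ℕ → ℕ} {H : Type*} [NormedAddCommGroup H] [InnerProductSpace ℂ H] [CompleteSpace H]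

theorem coordProj_succ_sq (Z : Set ℂ) (N : ℕ) : coordProj Z (N + 1) ^ 2 = coordProj Z N := by
  ext ξ
  exact (ξ.2 N).2

theorem inducedSemigroup_eq_toHom {Z : Set ℂ} (τ : BusbyInvariant (AdmissibleSpace Z) H)
    (t : PosDyadic) : inducedSemigroup τ t = τ.toHom (dyadicSemigroup (coordProj Z) t) := by
  rw [inducedSemigroup, dyadicSemigroup, dyadicSemigroup, map_pow]

theorem inducedSemigroup_add {Z : Set ℂ} (τ : BusbyInvariant (AdmissibleSpace Z) H)
    {s t u : PosDyadic} (h : (u : ℝ≥0) = s + t) :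
    inducedSemigroup τ u = inducedSemigroup τ s * inducedSemigroup τ t := by
  obtain ⟨k, m, -, hs⟩ := s.2
  obtain ⟨k', m', -, ht⟩ := t.2
  rw [inducedSemigroup_div τ s (k * 2 ^ m') (m + m') (by rw [hs, pow_add]; push_cast; field_simp),
    inducedSemigroup_div τ t (k' * 2 ^ m) (m + m') (by rw [ht, pow_add]; push_cast; field_simp),
    inducedSemigroup_div τ u (k * 2 ^ m' + k' * 2 ^ m) (m + m')
      (by rw [h, hs, ht, pow_add]; push_cast; field_simp), pow_add]

/-- Strong continuity in every Calkin representation needs only the pointwise convergence of the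
dyadic powers of the coordinate functions. -/
theorem isC0InCalkinRep_inducedSemigroup (hn : Tendsto n atTop atTop)
    (τ : BusbyInvariant (AdmissibleSpace (primeSet n)) H) (𝓤 : Ultrafilter ℕ)
    (h𝓤 : (𝓤 : Filter ℕ) ≤ cofinite) : IsC0InCalkinRep 𝓤 h𝓤 (inducedSemigroup τ) := by
  have := compactSpace_admissibleSpace hn
  have hrep : ∀ t : PosDyadic, calkinRep 𝓤 h𝓤 (inducedSemigroup τ t)
      = τ.rep 𝓤 h𝓤 (dyadicSemigroup (coordProj (primeSet n)) t) := fun t => by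
    rw [inducedSemigroup_eq_toHom]; rfl
  have hnorm : ∀ (t : PosDyadic) ξ, ‖dyadicSemigroup (coordProj (primeSet n)) t ξ‖ = 1 := by
    intro t ξ
    rw [dyadicSemigroup, ContinuousMap.pow_apply, norm_pow, norm_coordProj_apply hn, one_pow]
  refine exists_isC0Semigroup_extension (Q := fun t => calkinRep 𝓤 h𝓤 (inducedSemigroup τ t))
    (fun s t u h => ?_) (fun t => ?_) fun x => ?_
  · rw [inducedSemigroup_add τ h, map_mul]
  · rw [hrep]
    exact norm_starAlgHom_le_one_of_norm_eq_one _ (hnorm t)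
  · have h1 := tendsto_starAlgHom_apply_zero (τ.rep 𝓤 h𝓤)
      (l := comap (fun t : PosDyadic => (t : ℝ≥0)) (𝓝 0))
      (f := fun t => dyadicSemigroup (coordProj (primeSet n)) t - 1) (C := 2)
      (fun t ξ => by
        refine (norm_sub_le _ _).trans ?_
        rw [hnorm, ContinuousMap.one_apply, norm_one]
        norm_num)
      (fun ξ => by
        obtain ⟨C, hC⟩ := exists_norm_coordProj_pow_sub_one_le hn ξ
        have h2 : Tendsto (fun t : PosDyadic => C * ((t : ℝ≥0) : ℝ))
            (comap (fun t : PosDyadic => (t : ℝ≥0)) (𝓝 0)) (𝓝 0) := by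
          have h3 : Tendsto (fun s : ℝ≥0 => C * (s : ℝ)) (𝓝 0) (𝓝 0) :=
            (by fun_prop : Continuous fun s : ℝ≥0 => C * (s : ℝ)).tendsto' 0 0 (by simp)
          exact h3.comp tendsto_comap
        refine squeeze_zero_norm (fun t => ?_) h2
        obtain ⟨k, m, -, ht⟩ := t.2
        have h4 : ((t : ℝ≥0) : ℝ) = k / 2 ^ m := by rw [ht]; push_cast; rfl
        rw [dyadicSemigroup_div (coordProj_succ_sq _) t k m ht, h4]
        exact hC k m) x
    rw [tendsto_iff_norm_sub_tendsto_zero]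
    refine (tendsto_zero_iff_norm_tendsto_zero.1 h1).congr fun t => ?_
    rw [hrep, map_sub, map_one]
    rfl

/-- For an extension in the zero class `‖τ(g)‖ ≥ sup |g|`, so that uniform continuity of the
semigroup would force uniform convergence of the coordinates. -/
theorem not_isUniformlyContinuousSemigroup_inducedSemigroup (hn : Tendsto n atTop atTop)
    {τ : BusbyInvariant (AdmissibleSpace (primeSet n)) H} (hτ : τ.IsZero) :
    ¬ IsUniformlyContinuousSemigroup (inducedSemigroup τ) := by
  intro h
  let s : ℕ → PosDyadic := fun N => ⟨(1 : ℕ) / 2 ^ N, 1, N, one_pos, rfl⟩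
  have hs : Tendsto s atTop (comap (fun t : PosDyadic => (t : ℝ≥0)) (𝓝 0)) := by
    rw [tendsto_comap_iff]
    have := NNReal.tendsto_pow_atTop_nhds_zero_of_lt_one (by
      rw [← NNReal.coe_lt_coe]; norm_num : (2⁻¹ : ℝ≥0) < 1)
    refine this.congr fun N => ?_
    simp [s]
  obtain ⟨N₀, hN₀⟩ := eventually_atTop.1 ((h.comp hs).eventually_lt_const one_pos)
  obtain ⟨N, hN, ξ, hξ⟩ := exists_one_le_norm_coordProj_sub_one hn N₀
  have h1 := hN₀ N hN
  simp only [Function.comp_apply] at h1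
  rw [inducedSemigroup_div τ (s N) 1 N rfl, pow_one, ← map_one τ.toHom, ← map_sub] at h1
  have h2 := hτ.norm_apply_le (coordProj (primeSet n) N - 1) ξ
  exact absurd (hξ.trans h2) (not_le.2 h1)

end InducedSemigroup

end

/-! ### The example -/

theorem mainTheorem5 (n : ℕ → ℕ) (hn : Tendsto n atTop atTop) :
    -- `Z` is a closed subset of the imaginary axis
    (IsClosed (primeSet n) ∧ ∀ z ∈ primeSet n, z.re = 0) ∧
    -- the antipodal pairs in `X_N`
    (∀ N : ℕ, antipodalSet (expLevel (primeSet n) N) =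
      {w | ∃ j : ℕ, j.Prime ∧ 3 ≤ j ∧ n j = N ∧
        (w = Complex.exp (Complex.I * (angleα n j : ℂ) / 2 ^ N) ∨
          w = -Complex.exp (Complex.I * (angleα n j : ℂ) / 2 ^ N))}) ∧
    -- `π_N → 1` pointwise but not uniformly on `X`
    (∀ ξ : AdmissibleSpace (primeSet n),
      Tendsto (fun N => coordProj (primeSet n) N ξ) atTop (𝓝 1)) ∧
    (¬ TendstoUniformly (fun (N : ℕ) (ξ : AdmissibleSpace (primeSet n)) =>
      coordProj (primeSet n) N ξ) (fun _ => 1) atTop) ∧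
    -- the semigroup induced by the zero element of `Ext(X)`
    (∀ (H : Type*) [NormedAddCommGroup H] [InnerProductSpace ℂ H] [CompleteSpace H]
      [TopologicalSpace.SeparableSpace H], ¬ FiniteDimensional ℂ H →
      (∃ τ : BusbyInvariant (AdmissibleSpace (primeSet n)) H, τ.IsZero) ∧
      ∀ τ : BusbyInvariant (AdmissibleSpace (primeSet n)) H, τ.IsZero →
        (∀ (𝓤 : Ultrafilter ℕ) (h𝓤 : (𝓤 : Filter ℕ) ≤ cofinite),
          IsC0InCalkinRep 𝓤 h𝓤 (inducedSemigroup τ)) ∧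
        ¬ IsUniformlyContinuousSemigroup (inducedSemigroup τ)) := by
  have := compactSpace_admissibleSpace hn
  refine ⟨⟨isClosed_primeSet hn, ?_⟩, antipodalSet_expLevel_primeSet hn, tendsto_coordProj hn,
    not_tendstoUniformly_coordProj hn, fun H _ _ _ _ hH => ⟨?_, fun τ hτ =>
      ⟨isC0InCalkinRep_inducedSemigroup hn τ,
        not_isUniformlyContinuousSemigroup_inducedSemigroup hn hτ⟩⟩⟩
  · rintro z (⟨j, -, -, rfl⟩ | ⟨j, -, -, rfl⟩) <;> simp
  · have : SecondCountableTopology (AdmissibleSpace (primeSet n)) :=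
      Topology.IsInducing.subtypeVal.secondCountableTopology
    obtain ⟨b⟩ := exists_hilbertBasis_nat_prod_nat hH
    exact ⟨_, isZero_diagonalExtension b (TopologicalSpace.denseRange_denseSeq _)⟩
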